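/- Consider the linearized classical Boussinesq system on the half-line $$r_t+q_x=0,\qquad q_t+r_x-q_{xxt}=0\qquad (x>0,\ t>0),$$ with initial conditions $r(x,0)=r_0(x)$, $q(x,0)=q_0(x)$ for $x\ge 0$ and boundary condition $q(0,t)=g_0(t)$ for $t\ge 0$. Suppose that $(r,q)$ is a (complex-valued) solution such that $r,q$ are $C^\infty$ on $[0,\infty)\times[0,\infty)$ and decay as $x\to\infty$ in the following sense: for all $a\le 3$, $b\le 1$ and $T>0$, the derivatives $\partial_x^a\partial_t^b r$ and $\partial_x^a\partial_t^b q$ are $O((1+x)^{-2})$ uniformly for $0<t\le T$. Notation. Let $\hat f(k)=\int_0^\infty e^{-ikx}f(x)\,dx$ for $\operatorname{Im}k\le 0$ and $\widetilde f(\omega,t)=\int_0^t e^{-i\omega\tau}f(\tau)\,d\tau$. Let $\mu(k)=(1+k^2)^{1/2}$ be the branch with branch cut $i[-1,1]$ and $\mu(k)\sim k$ as $|k|\to\infty$ (on the cut, the limit from the right), that is $\mu(k)=\sqrt{|1+k^2|}\,e^{i(\theta_1+\theta_2-\pi)/2}$, where $\theta_1,\theta_2\in[0,2\pi)$ are the angles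 of $k+i$ and $k-i$ measured counterclockwise from the direction $-i$. Let $\omega=\omega(k)=k/\mu(k)$. Let $\mathcal C$ be any piecewise $C^1$ closed curve of finite length in the open upper half-plane that does not pass through $i$ and winds once counterclockwise around $i$. Then for all $x>0$ and $t\ge 0$ $$\begin{aligned} r(x,t)={}&\frac1{2\pi}\int_{\mathbb R}e^{ikx}\,\tfrac12\Big[(e^{i\omega t}+e^{-i\omega t})\hat r_0(k)-\mu(k)(e^{i\omega t}-e^{-i\omega t})\hat q_0(k)\Big]dk\\ &+\frac1{2\pi}\int_{\mathcal C}e^{ikx}\,\tfrac12\Big[(e^{i\omega t}+e^{-i\omega t})\hat r_0(-k)+\mu(k)(e^{i\omega t}-e^{-i\omega t})\hat q_0(-k)\Big]dk\\ &+\frac1{2\pi}\int_{\mathcal C}e^{ikx}\Big\{\big[e^{i\omega t}\widetilde g_0(\omega,t)+e^{-i\omega t}\widetilde g_0(-\omega,t)\big]+i\omega(k)\big[e^{i\omega t}\widetilde{g_0'}(\omega,t)-e^{-i\omega t}\widetilde{g_0'}(-\omega,t)\big]\Big\}dk \end{aligned}$$ and $$\begin{aligned} q(x,t)={}&\frac1{2\pi}\int_{\mathbb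 R}e^{ikx}\,\tfrac12\Big[(e^{i\omega t}+e^{-i\omega t})\hat q_0(k)-\tfrac1{\mu(k)}(e^{i\omega t}-e^{-i\omega t})\hat r_0(k)\Big]dk\\ &-\frac1{2\pi}\int_{\mathcal C}e^{ikx}\,\tfrac12\Big[(e^{i\omega t}+e^{-i\omega t})\hat q_0(-k)+\tfrac1{\mu(k)}(e^{i\omega t}-e^{-i\omega t})\hat r_0(-k)\Big]dk\\ &-\frac1{2\pi}\int_{\mathcal C}e^{ikx}\Big\{\tfrac1{\mu(k)}\big[e^{i\omega t}\widetilde g_0(\omega,t)-e^{-i\omega t}\widetilde g_0(-\omega,t)\big]+\tfrac{ik}{1+k^2}\big[e^{i\omega t}\widetilde{g_0'}(\omega,t)+e^{-i\omega t}\widetilde{g_0'}(-\omega,t)\big]\Big\}dk. \end{aligned}$$ Here the integral over $\mathbb R$ in the formula for $q$ converges as an improper integral $\lim_{a\to-\infty,\,b\to\infty}\int_a^b$. The integral over $\mathbb R$ in the formula for $r$ exists in the sense of Abel, i.e. as $\lim_{\varepsilon\to0^+}\int_{\mathbb R}e^{-\varepsilon|k|}(\cdots)\,dk$, and it converges as an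 improper integral, with the same value, whenever $q_0(0)\sin t=0$ (in particular whenever $q_0(0)=0$). -/

import Mathlib

open Complex Set Filter Topology MeasureTheory
open scoped ContDiff

noncomputable section

namespace LinearBoussinesq

/-- The mixed partial derivative `∂ₜᵇ ∂ₓᵃ u` at the point `(x, t)`. -/
def partialDeriv (a b : ℕ) (u : ℝ → ℝ → ℂ) (x t : ℝ) : ℂ :=
  iteratedDeriv b (fun s => iteratedDeriv a (fun y => u y s) x) t

/-- `(r, q)` solves the linearized classical Boussinesq system on the half-line with initial data
`r₀, q₀` and Dirichlet datum `g₀`, and is smooth on the closed quarter-plane. -/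
structure IsSmoothSolution (r₀ q₀ g₀ : ℝ → ℂ) (r q : ℝ → ℝ → ℂ) : Prop where
  smooth_r : ContDiffOn ℝ ∞ (fun p : ℝ × ℝ => r p.1 p.2) (Ici 0 ×ˢ Ici 0)
  smooth_q : ContDiffOn ℝ ∞ (fun p : ℝ × ℝ => q p.1 p.2) (Ici 0 ×ˢ Ici 0)
  eq_r : ∀ x t : ℝ, 0 < x → 0 < t →
    partialDeriv 0 1 r x t + partialDeriv 1 0 q x t = 0
  eq_q : ∀ x t : ℝ, 0 < x → 0 < t →
    partialDeriv 0 1 q x t + partialDeriv 1 0 r x t - partialDeriv 2 1 q x t = 0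
  init_r : ∀ x : ℝ, 0 ≤ x → r x 0 = r₀ x
  init_q : ∀ x : ℝ, 0 ≤ x → q x 0 = q₀ x
  bdry_q : ∀ t : ℝ, 0 ≤ t → q 0 t = g₀ t

/-- Decay as `x → ∞`, locally uniformly in `t`: the derivatives `∂ₓᵃ ∂ₜᵇ u` with `a ≤ 3`, `b ≤ 1`
are `O((1 + x)⁻²)`. Every function that is of Schwartz class in `x` (locally uniformly in `t`,
together with its first time derivative) has this property. -/
def DecaysAtInfinity (u : ℝ → ℝ → ℂ) : Prop :=
  ∀ a b : ℕ, a ≤ 3 → b ≤ 1 → ∀ T : ℝ, 0 < T → ∃ M : ℝ, ∀ x t : ℝ, 0 < x → 0 < t → t ≤ T →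
    ‖partialDeriv a b u x t‖ ≤ M / (1 + x) ^ 2

/-- The half-line Fourier transform `f̂(k) = ∫₀^∞ e^{-ikx} f(x) dx`. -/
def halfFourier (f : ℝ → ℂ) (k : ℂ) : ℂ :=
  ∫ x in Ioi (0 : ℝ), exp (-I * k * x) * f x

/-- The time transform `f̃(ω, t) = ∫₀^t e^{-iωτ} f(τ) dτ`. -/
def timeTransform (f : ℝ → ℂ) (w : ℂ) (t : ℝ) : ℂ :=
  ∫ τ in (0 : ℝ)..t, exp (-I * w * τ) * f τ

/-- The angle in `[0, 2π)` of `z`, measured counterclockwise from the direction `-i`. -/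
def angleFromBelow (z : ℂ) : ℝ := toIcoMod Real.two_pi_pos 0 (arg (I * z))

/-- The branch of `(1 + k²)^{1/2}` with cut `i[-1, 1]` and `μ(k) ∼ k` at infinity; on the cut the
formula gives the limit from the right. -/
def mu (k : ℂ) : ℂ :=
  (Real.sqrt ‖1 + k ^ 2‖ : ℂ) *
    exp (I * ((angleFromBelow (k + I) + angleFromBelow (k - I) - Real.pi : ℝ) : ℂ) / 2)

/-- The dispersion relation `ω(k) = k / μ(k)`. -/
def omega (k : ℂ) : ℂ := k / mu k

/-- `∫_γ F(k) dk` for a curve `γ` parametrized by `[0, 1]`. -/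
def contourIntegral (γ : ℝ → ℂ) (F : ℂ → ℂ) : ℂ :=
  ∫ s in (0 : ℝ)..1, F (γ s) * deriv γ s

/-- `γ` is a piecewise continuously differentiable closed curve of finite length in the open upper
half-plane that winds once, counterclockwise, around the point `i`. -/
structure IsContourAroundI (γ : ℝ → ℂ) : Prop where
  continuousOn : ContinuousOn γ (Icc 0 1)
  closed : γ 0 = γ 1
  piecewise : ∃ P : Set ℝ, P.Finite ∧ ContDiffOn ℝ 1 γ (Ioo 0 1 \ P)
  finiteLength : IntervalIntegrable (deriv γ) volume 0 1
  upper : ∀ s ∈ Icc (0 : ℝ) 1, 0 < (γ s).im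
  avoids : ∀ s ∈ Icc (0 : ℝ) 1, γ s ≠ I
  winding : contourIntegral γ (fun k => 1 / (k - I)) = 2 * Real.pi * I

/-- `∫_ℝ F(k) dk = L` as an improper integral, the two ends tending to infinity independently. -/
def HasImproperIntegral (F : ℝ → ℂ) (L : ℂ) : Prop :=
  (∀ a b : ℝ, IntervalIntegrable F volume a b) ∧
    Tendsto (fun p : ℝ × ℝ => ∫ k in p.1..p.2, F k) (atBot ×ˢ atTop) (𝓝 L)

/-- `∫_ℝ F(k) dk = L` in the sense of Abel: `L` is the limit of `∫_ℝ e^{-ε|k|} F(k) dk` as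
`ε → 0+`. -/
def HasAbelIntegral (F : ℝ → ℂ) (L : ℂ) : Prop :=
  (∀ ε : ℝ, 0 < ε → Integrable (fun k : ℝ => (Real.exp (-ε * |k|) : ℂ) * F k)) ∧
    Tendsto (fun ε : ℝ => ∫ k : ℝ, (Real.exp (-ε * |k|) : ℂ) * F k) (𝓝[>] 0) (𝓝 L)

/-- `e^{iωt} + e^{-iωt}` with `ω = ω(k)`. -/
def expSum (k : ℂ) (t : ℝ) : ℂ := exp (I * omega k * t) + exp (-I * omega k * t)

/-- `e^{iωt} - e^{-iωt}` with `ω = ω(k)`. -/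
def expDiff (k : ℂ) (t : ℝ) : ℂ := exp (I * omega k * t) - exp (-I * omega k * t)

/-- `e^{iωt} f̃(ω, t) + e^{-iωt} f̃(-ω, t)` with `ω = ω(k)`. -/
def transSum (f : ℝ → ℂ) (k : ℂ) (t : ℝ) : ℂ :=
  exp (I * omega k * t) * timeTransform f (omega k) t +
    exp (-I * omega k * t) * timeTransform f (-omega k) t

/-- `e^{iωt} f̃(ω, t) - e^{-iωt} f̃(-ω, t)` with `ω = ω(k)`. -/
def transDiff (f : ℝ → ℂ) (k : ℂ) (t : ℝ) : ℂ :=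
  exp (I * omega k * t) * timeTransform f (omega k) t -
    exp (-I * omega k * t) * timeTransform f (-omega k) t

end LinearBoussinesq

end

noncomputable section

namespace LinearBoussinesq

/-! ### Contour integrals in the punctured upper half-plane -/

/-! For `Im k ≤ 0` the half-line transforms `R`, `Q` of `r`, `q` solve `R' = g₀ - ikQ` and `(1 +
k²)Q' = h - ik g₁ - ikR`, where `g₁ = g₀'` and `h = r(0,t) - q_xt(0,t)` is not prescribed. The
homogeneous flow rotates with frequency `ω = k/μ`, so variation of constants (`duhamel`) writes `R`,
`Q` as initial data plus boundary convolutions. These convolutions are even in `μ`, hence analytic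
off `±i` despite the cut; `boundaryForm` is their common shape, with coefficients entire in `ω² = 1
- 1/(1 + k²)`.

Fourier inversion on the real line recovers `r` and `q`. The boundary part of the inversion integral
is moved to the contour around `i` by `hasImproperIntegral_boundaryForm`, once its limit `A 1` at `k
= ∞` (where `ω² = 1`) is removed. This limit is zero for `q` and `q₀(0) sin t` for `r`; the
resulting `A 1 * e^{ikx}` has Abel integral zero, which is why the formula for `r` needs Abel
summation in general.

The unknown `h` is eliminated with the same relation at `-k`. For `k` in the upper half-plane,
`e^{ikx} R(-k)` and `e^{ikx} Q(-k)` are analytic and integrate to zero over the contour. Replacing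
`(k, μ)` by `(-k, -μ)` keeps `ω`, so adding (for `r`) or subtracting (for `q`) cancels `h` and
doubles the terms in `g₀`, `g₁`.

The deformation from the real line to the contour uses `ζ = log((k - i)/(k + i))`: the punctured
upper half-plane is covered by `Re ζ < 0`, the contour lifts to a path from `ζ₀` to `ζ₀ + 2πi`, the
real line is `Re ζ = 0`, and `dk/(1 + k²) = dζ/(2i)`. Terms with only `1/k` decay are first
integrated by parts. -/

theorem mem_ball_mul_iff {u z : ℂ} {R : ℝ} (hu : u.re ^ 2 + u.im ^ 2 = 1) (hR : 0 < R) :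
    z ∈ Metric.ball ((R : ℂ) * u) R ↔
      z.re ^ 2 + z.im ^ 2 < 2 * R * (u.re * z.re + u.im * z.im) := by
  rw [Metric.mem_ball, dist_eq_norm, ← sq_lt_sq₀ (norm_nonneg _) hR.le, Complex.sq_norm,
    normSq_apply]
  simp only [sub_re, mul_re, ofReal_re, ofReal_im, zero_mul, sub_zero, sub_im, mul_im, add_zero]
  have : R ^ 2 * (u.re ^ 2 + u.im ^ 2) = R ^ 2 := by rw [hu, mul_one]
  constructor <;> intro h <;> nlinarith

/-- A compact subset of an open half-plane lies in a disc contained in that half-plane. -/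
theorem exists_ball_superset_of_isCompact {u : ℂ} (hu : u.re ^ 2 + u.im ^ 2 = 1) {K : Set ℂ}
    (hK : IsCompact K) (hpos : ∀ z ∈ K, 0 < u.re * z.re + u.im * z.im) :
    ∃ R : ℝ, K ⊆ Metric.ball ((R : ℂ) * u) R ∧
      ∀ z ∈ Metric.ball ((R : ℂ) * u) R, 0 < u.re * z.re + u.im * z.im := by
  -- The discs tangent at the origin to the bounding line exhaust the half-plane: `z` lies in the
  -- one of radius `R` as soon as `2R` exceeds this quotient, which is bounded on `K`.
  have hcont : ContinuousOn
      (fun z : ℂ => (z.re ^ 2 + z.im ^ 2) / (u.re * z.re + u.im * z.im)) K := by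
    refine ContinuousOn.div (by fun_prop) (by fun_prop) fun z hz => (hpos z hz).ne'
  obtain ⟨B, hB⟩ := (hK.image_of_continuousOn hcont).bddAbove
  refine ⟨|B| + 1, ?_, ?_⟩
  · intro z hz
    have h1 := hB (mem_image_of_mem _ hz)
    have h2 := hpos z hz
    rw [mem_ball_mul_iff hu (by positivity)]
    rw [div_le_iff₀ h2] at h1
    have h3 := le_abs_self B
    have h4 := abs_nonneg B
    nlinarith
  · intro z hz
    rw [mem_ball_mul_iff hu (by positivity)] at hz
    have h4 := abs_nonneg B
    by_contra hcon
    push Not at hcon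
    nlinarith [sq_nonneg z.re, sq_nonneg z.im]

namespace IsContourAroundI

variable {γ : ℝ → ℂ}

theorem intervalIntegrable_mul_deriv (hγ : IsContourAroundI γ) {F : ℝ → ℂ}
    (hF : ContinuousOn F (Icc 0 1)) :
    IntervalIntegrable (fun s => F s * deriv γ s) volume 0 1 :=
  hγ.finiteLength.continuousOn_mul (by rwa [uIcc_of_le zero_le_one])

theorem intervalIntegrable_comp (hγ : IsContourAroundI γ) {F : ℂ → ℂ}
    (hF : ContinuousOn F ({k | 0 < k.im} \ {I})) :
    IntervalIntegrable (fun s => F (γ s) * deriv γ s) volume 0 1 :=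
  hγ.intervalIntegrable_mul_deriv (F := fun s => F (γ s))
    (hF.comp hγ.continuousOn fun s hs => ⟨hγ.upper s hs, hγ.avoids s hs⟩)

/-- The fundamental theorem of calculus along a contour, for a primitive along the curve. -/
theorem contourIntegral_eq_sub (hγ : IsContourAroundI γ) {F : ℂ → ℂ} {G : ℝ → ℂ}
    {P : Set ℝ} (hP : P.Finite)
    (hF : ContinuousOn (fun s => F (γ s)) (Icc 0 1)) (hG : ContinuousOn G (Icc 0 1))
    (hd : ∀ s ∈ Ioo (0 : ℝ) 1 \ P, HasDerivAt G (F (γ s) * deriv γ s) s) :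
    contourIntegral γ F = G 1 - G 0 :=
  integral_eq_of_hasDerivAt_off_countable_of_le G _ zero_le_one hP.countable hG hd
    (hγ.intervalIntegrable_mul_deriv (F := fun s => F (γ s)) hF)

theorem contourIntegral_eq_zero_of_hasDerivAt (hγ : IsContourAroundI γ) {F H : ℂ → ℂ}
    (hF : ContinuousOn (fun s => F (γ s)) (Icc 0 1))
    (hH : ∀ s ∈ Icc (0 : ℝ) 1, HasDerivAt H (F (γ s)) (γ s)) : contourIntegral γ F = 0 := by
  obtain ⟨P, hP, hsm⟩ := hγ.piecewise
  have hopen : IsOpen (Ioo (0 : ℝ) 1 \ P) := isOpen_Ioo.sdiff hP.isClosed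
  rw [hγ.contourIntegral_eq_sub (G := fun s => H (γ s)) hP hF, hγ.closed, sub_self]
  · intro s hs
    exact (hH s hs).continuousAt.comp_continuousWithinAt (hγ.continuousOn s hs)
  · intro s hs
    have h1 : HasDerivAt γ (deriv γ s) s :=
      ((hsm.differentiableOn one_ne_zero).differentiableAt (hopen.mem_nhds hs)).hasDerivAt
    exact (hH s (Ioo_subset_Icc_self hs.1)).comp s h1

/-- Cauchy's theorem for a contour in the upper half-plane. -/
theorem contourIntegral_eq_zero_of_differentiableOn (hγ : IsContourAroundI γ) {F : ℂ → ℂ}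
    (hF : DifferentiableOn ℂ F {k | 0 < k.im}) : contourIntegral γ F = 0 := by
  obtain ⟨R, hR, hR'⟩ := exists_ball_superset_of_isCompact (u := I) (by simp)
    (isCompact_Icc.image_of_continuousOn hγ.continuousOn) (by
      rintro _ ⟨s, hs, rfl⟩
      simpa using hγ.upper s hs)
  have hd : DifferentiableOn ℂ F (Metric.ball ((R : ℂ) * I) R) :=
    hF.mono fun z hz => by simpa using hR' z hz
  obtain ⟨H, hH⟩ := hd.isExactOn_ball
  refine hγ.contourIntegral_eq_zero_of_hasDerivAt (H := H) ?_ fun s hs =>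
    hH _ (hR (mem_image_of_mem _ hs))
  exact hF.continuousOn.comp hγ.continuousOn fun s hs => hγ.upper s hs

/-- The contour lifts to the logarithmic coordinate `ζ`, `e^ζ = (k - i) / (k + i)`, and the lift
increases by `2πi`. -/
theorem exists_log_lift (hγ : IsContourAroundI γ) :
    ∃ (ζ : ℝ → ℂ) (P : Set ℝ), P.Finite ∧ ContinuousOn ζ (Icc 0 1) ∧
    (∀ s ∈ Ioo (0 : ℝ) 1 \ P,
      HasDerivAt ζ ((1 / (γ s - I) - 1 / (γ s + I)) * deriv γ s) s) ∧
    (∀ s ∈ Icc (0 : ℝ) 1, exp (ζ s) = (γ s - I) / (γ s + I)) ∧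
    ζ 1 = ζ 0 + 2 * Real.pi * I := by
  obtain ⟨P, hP, hsm⟩ := hγ.piecewise
  have hopen : IsOpen (Ioo (0 : ℝ) 1 \ P) := isOpen_Ioo.sdiff hP.isClosed
  have hm : ∀ s ∈ Icc (0 : ℝ) 1, γ s - I ≠ 0 := fun s hs => sub_ne_zero.2 (hγ.avoids s hs)
  have hp : ∀ s ∈ Icc (0 : ℝ) 1, γ s + I ≠ 0 := fun s hs h => by
    have := hγ.upper s hs
    have h2 := congrArg Complex.im h
    simp at h2
    linarith
  have hγc := hγ.continuousOn
  have hc1 : ContinuousOn (fun s => 1 / (γ s - I)) (Icc 0 1) :=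
    continuousOn_const.div (by fun_prop) hm
  have hc2 : ContinuousOn (fun s => 1 / (γ s + I)) (Icc 0 1) :=
    continuousOn_const.div (by fun_prop) hp
  set l : ℝ → ℂ := fun s => (1 / (γ s - I) - 1 / (γ s + I)) * deriv γ s with hl
  have hli : IntervalIntegrable l volume 0 1 :=
    hγ.intervalIntegrable_mul_deriv (hc1.sub hc2)
  have hw0 : (γ 0 - I) / (γ 0 + I) ≠ 0 :=
    div_ne_zero (hm 0 (by simp)) (hp 0 (by simp))
  -- Integrating the logarithmic derivative avoids choosing branches of `log` along the curve.
  set ζ : ℝ → ℂ := fun s => log ((γ 0 - I) / (γ 0 + I)) + ∫ u in (0 : ℝ)..s, l u with hζ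
  have hζc : ContinuousOn ζ (Icc 0 1) := by
    refine continuousOn_const.add ?_
    have := intervalIntegral.continuousOn_primitive_interval (f := l) (μ := volume)
      (a := 0) (b := 1) (by
        rw [uIcc_of_le zero_le_one, integrableOn_Icc_iff_integrableOn_Ioc]
        exact (intervalIntegrable_iff_integrableOn_Ioc_of_le zero_le_one).1 hli)
    rwa [uIcc_of_le zero_le_one] at this
  have hγd : ∀ s ∈ Ioo (0 : ℝ) 1 \ P, HasDerivAt γ (deriv γ s) s := fun s hs =>
    ((hsm.differentiableOn one_ne_zero).differentiableAt (hopen.mem_nhds hs)).hasDerivAt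
  have hlc : ContinuousOn l (Ioo (0 : ℝ) 1 \ P) := by
    refine ContinuousOn.mul ((hc1.sub hc2).mono fun s hs => Ioo_subset_Icc_self hs.1) ?_
    exact hsm.continuousOn_deriv_of_isOpen hopen le_rfl
  have hζd : ∀ s ∈ Ioo (0 : ℝ) 1 \ P, HasDerivAt ζ (l s) s := by
    intro s hs
    refine HasDerivAt.const_add _ (intervalIntegral.integral_hasDerivAt_right ?_ ?_ ?_)
    · exact hli.mono_set (by
        rw [uIcc_of_le zero_le_one, uIcc_of_le hs.1.1.le]
        exact Icc_subset_Icc_right hs.1.2.le)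
    · exact hlc.stronglyMeasurableAtFilter hopen s hs
    · exact hlc.continuousAt (hopen.mem_nhds hs)
  have hexp : ∀ s ∈ Icc (0 : ℝ) 1, exp (ζ s) = (γ s - I) / (γ s + I) := by
    intro s hs
    -- The product of `exp (-ζ)` and `(γ - i)/(γ + i)` has derivative zero off `P`, so it keeps its
    -- initial value 1.
    have h0 := integral_eq_of_hasDerivAt_off_countable_of_le
      (fun u => exp (-ζ u) * ((γ u - I) / (γ u + I))) (fun _ => 0) hs.1 hP.countable
      (by
        have hsub : Icc 0 s ⊆ Icc (0 : ℝ) 1 := Icc_subset_Icc_right hs.2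
        have h1 := hζc.mono hsub
        have h2 := hγc.mono hsub
        refine ContinuousOn.mul (by fun_prop) (ContinuousOn.div (by fun_prop) (by fun_prop)
          fun u hu => hp u (hsub hu))) (by
        intro u hu
        have hu1 : u ∈ Ioo (0 : ℝ) 1 \ P := ⟨⟨hu.1.1, hu.1.2.trans_le hs.2⟩, hu.2⟩
        have hu2 := Ioo_subset_Icc_self hu1.1
        have := ((hζd u hu1).neg.cexp).mul
          (((hγd u hu1).sub_const I).div ((hγd u hu1).add_const I) (hp u hu2))
        refine this.congr_deriv ?_
        have e1 := hm u hu2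
        have e2 := hp u hu2
        simp only [hl, Pi.div_apply]
        field_simp
        ring) (by simp)
    have h1 : exp (-ζ 0) * ((γ 0 - I) / (γ 0 + I)) = 1 := by
      simp only [hζ, intervalIntegral.integral_same, add_zero, exp_neg, exp_log hw0]
      exact inv_mul_cancel₀ hw0
    simp only [intervalIntegral.integral_zero] at h0
    rw [h1, eq_comm, sub_eq_zero, exp_neg] at h0
    have h2 := exp_ne_zero (ζ s)
    field_simp at h0
    rw [← h0]
  refine ⟨ζ, P, hP, hζc, hζd, hexp, ?_⟩
  -- The pole `-i` lies outside the upper half-plane, so only the winding around `i` contributes to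
  -- the increment of `ζ`.
  have hz0 : contourIntegral γ (fun k => 1 / (k + I)) = 0 := by
    refine hγ.contourIntegral_eq_zero_of_differentiableOn ?_
    refine (differentiableOn_const _).div (by fun_prop) fun k hk h => ?_
    have h2 := congrArg Complex.im h
    simp at h2 hk
    linarith
  have hsplit : ∫ u in (0 : ℝ)..1, l u
      = contourIntegral γ (fun k => 1 / (k - I)) - contourIntegral γ (fun k => 1 / (k + I)) := by
    unfold contourIntegral
    rw [← intervalIntegral.integral_sub (hγ.intervalIntegrable_mul_deriv hc1)
      (hγ.intervalIntegrable_mul_deriv hc2)]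
    congr 1
    ext s
    simp only [hl]
    ring
  simp only [hζ, hsplit, hz0, hγ.winding, intervalIntegral.integral_same, sub_zero, add_zero]

end IsContourAroundI

/-! ### The logarithmic coordinate and the passage from the contour to the real line -/

/-- The point `k` with `(k - i) / (k + i) = e^ζ`. -/
def logParam (ζ : ℂ) : ℂ := I * (1 + exp ζ) / (1 - exp ζ)

theorem logParam_sub_I {ζ : ℂ} (h : exp ζ ≠ 1) :
    logParam ζ - I = 2 * I * exp ζ / (1 - exp ζ) := by
  have : 1 - exp ζ ≠ 0 := sub_ne_zero.2 h.symm
  unfold logParam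
  field_simp
  ring

theorem logParam_add_I {ζ : ℂ} (h : exp ζ ≠ 1) : logParam ζ + I = 2 * I / (1 - exp ζ) := by
  have : 1 - exp ζ ≠ 0 := sub_ne_zero.2 h.symm
  unfold logParam
  field_simp
  ring

theorem logParam_ne_I {ζ : ℂ} (h : exp ζ ≠ 1) : logParam ζ ≠ I := by
  rw [← sub_ne_zero, logParam_sub_I h]
  have : 1 - exp ζ ≠ 0 := sub_ne_zero.2 h.symm
  have := exp_ne_zero ζ
  simp [*]

theorem logParam_ne_neg_I {ζ : ℂ} (h : exp ζ ≠ 1) : logParam ζ ≠ -I := by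
  have h0 : logParam ζ + I ≠ 0 := by
    rw [logParam_add_I h]
    have : 1 - exp ζ ≠ 0 := sub_ne_zero.2 h.symm
    simp [*]
  intro h1
  simp [h1] at h0

theorem logParam_mem_compl {ζ : ℂ} (h : exp ζ ≠ 1) : logParam ζ ∈ ({I, -I} : Set ℂ)ᶜ := by
  simp only [mem_compl_iff, mem_insert_iff, mem_singleton_iff, not_or]
  exact ⟨logParam_ne_I h, logParam_ne_neg_I h⟩

/-- Vertical lines in `ζ` become Apollonius circles of `±i`, so the sign of `Re ζ` decides the side
of the real axis. -/
theorem norm_logParam_sub_I {ζ : ℂ} (h : exp ζ ≠ 1) :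
    ‖logParam ζ - I‖ = Real.exp ζ.re * ‖logParam ζ + I‖ := by
  rw [logParam_sub_I h, logParam_add_I h, mul_div_right_comm, norm_mul, norm_exp, mul_comm]

theorem im_nonneg_of_norm_le {k : ℂ} (h : ‖k - I‖ ≤ ‖k + I‖) : 0 ≤ k.im := by
  rw [← sq_le_sq₀ (norm_nonneg _) (norm_nonneg _), Complex.sq_norm, Complex.sq_norm,
    normSq_apply, normSq_apply] at h
  simp at h
  nlinarith

theorem logParam_im_nonneg {ζ : ℂ} (h : exp ζ ≠ 1) (hre : ζ.re ≤ 0) : 0 ≤ (logParam ζ).im := by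
  refine im_nonneg_of_norm_le ?_
  rw [norm_logParam_sub_I h]
  exact mul_le_of_le_one_left (norm_nonneg _) (Real.exp_le_one_iff.2 hre)

theorem exp_ne_one_of_re_neg {ζ : ℂ} (h : ζ.re < 0) : exp ζ ≠ 1 := by
  intro h1
  have h2 := norm_exp ζ
  rw [h1, norm_one] at h2
  have := Real.exp_lt_one_iff.2 h
  linarith

theorem differentiableAt_logParam {ζ : ℂ} (h : exp ζ ≠ 1) : DifferentiableAt ℂ logParam ζ := by
  have : 1 - exp ζ ≠ 0 := sub_ne_zero.2 h.symm
  unfold logParam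
  fun_prop (disch := assumption)

theorem logParam_of_exp_eq {ζ k : ℂ} (hk : k + I ≠ 0) (h : exp ζ = (k - I) / (k + I)) :
    logParam ζ = k := by
  have h1 : 1 - exp ζ = 2 * I / (k + I) := by
    rw [h]
    field_simp
    ring
  have h2 : 1 + exp ζ = 2 * k / (k + I) := by
    rw [h]
    field_simp
    ring
  have hI := I_ne_zero
  rw [logParam, h1, h2]
  field_simp

theorem isOpen_compl_I_neg_I : IsOpen ({I, -I} : Set ℂ)ᶜ :=
  (Set.toFinite _).isClosed.isOpen_compl

theorem upper_sdiff_subset_compl : {k : ℂ | 0 < k.im} \ {I} ⊆ ({I, -I} : Set ℂ)ᶜ := by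
  rintro k ⟨hk, hkI⟩
  simp only [mem_compl_iff, mem_insert_iff, mem_singleton_iff, not_or]
  refine ⟨hkI, ?_⟩
  rintro rfl
  simp at hk
  linarith

/-- A contour around `i` may be replaced by the circle `|k - i| = e^{-δ} |k + i|`. -/
theorem IsContourAroundI.contourIntegral_eq_circle {γ : ℝ → ℂ} (hγ : IsContourAroundI γ)
    {Φ : ℂ → ℂ} (hΦ : DifferentiableOn ℂ Φ ({I, -I} : Set ℂ)ᶜ) {δ : ℝ} (hδ : 0 < δ) :
    contourIntegral γ (fun k => Φ k / (1 + k ^ 2)) =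
      ∫ θ in (0 : ℝ)..2 * Real.pi, 1 / 2 * Φ (logParam (-δ + θ * I)) := by
  obtain ⟨ζ, P, hP, hζc, hζd, hexp, hper⟩ := hγ.exists_log_lift
  have hp : ∀ s ∈ Icc (0 : ℝ) 1, γ s + I ≠ 0 := fun s hs h => by
    have := hγ.upper s hs
    have h2 := congrArg Complex.im h
    simp at h2
    linarith
  have hm : ∀ s ∈ Icc (0 : ℝ) 1, γ s - I ≠ 0 := fun s hs => sub_ne_zero.2 (hγ.avoids s hs)
  have hγζ : ∀ s ∈ Icc (0 : ℝ) 1, logParam (ζ s) = γ s := fun s hs =>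
    logParam_of_exp_eq (hp s hs) (hexp s hs)
  have hneg : ∀ s ∈ Icc (0 : ℝ) 1, (ζ s).re < 0 := by
    intro s hs
    rw [← Real.exp_lt_one_iff, ← norm_exp, hexp s hs, norm_div,
      div_lt_one (norm_pos_iff.2 (hp s hs)), ← sq_lt_sq₀ (norm_nonneg _) (norm_nonneg _),
      Complex.sq_norm, Complex.sq_norm, normSq_apply, normSq_apply]
    have := hγ.upper s hs
    simp
    nlinarith
  -- The factor `-(I / 2)` is `1/(2i)`, from `dk/(1 + k²) = dζ/(2i)`.
  set Ψ : ℂ → ℂ := fun z => -(I / 2) * Φ (logParam z) with hΨ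
  have hΨd : DifferentiableOn ℂ Ψ {z | z.re < 0} := by
    intro z hz
    have h1 := exp_ne_one_of_re_neg hz
    have h2 : DifferentiableAt ℂ Φ (logParam z) :=
      hΦ.differentiableAt (isOpen_compl_I_neg_I.mem_nhds (logParam_mem_compl h1))
    exact ((h2.comp z (differentiableAt_logParam h1)).const_mul _).differentiableWithinAt
  set c : ℝ → ℂ := fun θ => -(δ : ℂ) + θ * I with hc
  have hcc : Continuous c := by fun_prop
  have hcre : ∀ θ, (c θ).re < 0 := fun θ => by simp [hc, hδ]
  -- One disc in `Re ζ < 0` contains both the lifted contour and the vertical segment, so a single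
  -- primitive `H` serves for both.
  obtain ⟨R, hR, hR'⟩ := exists_ball_superset_of_isCompact (u := -1) (by simp)
    ((isCompact_Icc.image_of_continuousOn hζc).union
      ((isCompact_Icc (a := (0 : ℝ)) (b := 2 * Real.pi)).image hcc)) (by
      rintro _ (⟨s, hs, rfl⟩ | ⟨θ, -, rfl⟩)
      · simpa using hneg s hs
      · simpa using hcre θ)
  set B := Metric.ball ((R : ℂ) * -1) R with hB
  have hBneg : ∀ z ∈ B, z.re < 0 := fun z hz => by simpa using hR' z hz
  obtain ⟨H, hH⟩ := (hΨd.mono hBneg).isExactOn_ball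
  have hζB : ∀ s ∈ Icc (0 : ℝ) 1, ζ s ∈ B := fun s hs => hR (Or.inl (mem_image_of_mem _ hs))
  have hcB : ∀ θ ∈ Icc (0 : ℝ) (2 * Real.pi), c θ ∈ B := fun s hs =>
    hR (Or.inr (mem_image_of_mem _ hs))
  have hpi := Real.two_pi_pos
  have e1 : contourIntegral γ (fun k => Φ k / (1 + k ^ 2)) = H (ζ 1) - H (ζ 0) := by
    refine hγ.contourIntegral_eq_sub (G := fun s => H (ζ s)) hP ?_ ?_ ?_
    · refine ContinuousOn.div ?_ ?_ ?_
      · exact hΦ.continuousOn.comp hγ.continuousOn fun s hs =>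
          upper_sdiff_subset_compl ⟨hγ.upper s hs, hγ.avoids s hs⟩
      · have := hγ.continuousOn
        fun_prop
      · intro s hs
        have h := mul_ne_zero (hm s hs) (hp s hs)
        rwa [show (γ s - I) * (γ s + I) = 1 + γ s ^ 2 by linear_combination -I_sq] at h
    · intro s hs
      exact (hH _ (hζB s hs)).continuousAt.comp_continuousWithinAt (hζc s hs)
    · intro s hs
      have hs' := Ioo_subset_Icc_self hs.1
      refine ((hH _ (hζB s hs')).comp s (hζd s hs)).congr_deriv ?_
      have h1 := hm s hs'
      have h2 := hp s hs'
      simp only [hΨ, hγζ s hs']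
      rw [show 1 + γ s ^ 2 = (γ s - I) * (γ s + I) by linear_combination I_sq]
      field_simp
      linear_combination (-2 * Φ (γ s) * deriv γ s) * I_sq
  have e2 : H (c (2 * Real.pi)) - H (c 0)
      = ∫ θ in (0 : ℝ)..2 * Real.pi, 1 / 2 * Φ (logParam (c θ)) := by
    have hΨc : Continuous fun θ => Φ (logParam (c θ)) := by
      refine continuous_iff_continuousAt.2 fun θ => ?_
      have h1 := exp_ne_one_of_re_neg (hcre θ)
      have h2 : DifferentiableAt ℂ Φ (logParam (c θ)) :=
        hΦ.differentiableAt (isOpen_compl_I_neg_I.mem_nhds (logParam_mem_compl h1))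
      exact ContinuousAt.comp (f := fun θ => logParam (c θ)) h2.continuousAt
        ((differentiableAt_logParam h1).continuousAt.comp hcc.continuousAt)
    symm
    refine integral_eq_of_hasDerivAt_off_countable_of_le (fun θ => H (c θ)) _ hpi.le
      countable_empty ?_ ?_ ((continuous_const.mul hΨc).intervalIntegrable _ _)
    · intro θ hθ
      exact (hH _ (hcB θ hθ)).continuousAt.comp_continuousWithinAt hcc.continuousWithinAt
    · intro θ hθ
      have hd : HasDerivAt c I θ := by
        simpa [hc] using ((Complex.ofRealCLM.hasDerivAt (x := θ)).mul_const I).const_add (-(δ : ℂ))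
      refine ((hH _ (hcB θ (Ioo_subset_Icc_self hθ.1))).comp θ hd).congr_deriv ?_
      simp only [hΨ]
      linear_combination (-1 / 2 * Φ (logParam (c θ))) * I_sq
  -- `Ψ` has period `2πi`, so the increment of `H` over one period is locally constant. It is
  -- constant on `U`, an intersection of a disc with a translate of itself and hence convex.
  have e3 : H (ζ 0 + 2 * Real.pi * I) - H (ζ 0) = H (c 0 + 2 * Real.pi * I) - H (c 0) := by
    set U : Set ℂ := B ∩ (fun z => z + 2 * Real.pi * I) ⁻¹' B with hU
    have hUo : IsOpen U :=
      Metric.isOpen_ball.inter (Metric.isOpen_ball.preimage (by fun_prop))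
    have hUc : Convex ℝ U := by
      refine (convex_ball _ _).inter ?_
      exact (convex_ball ((R : ℂ) * -1) R).translate_preimage_left (2 * Real.pi * I)
    have hd : ∀ z ∈ U, HasDerivAt (fun z => H (z + 2 * Real.pi * I) - H z) 0 z := by
      intro z hz
      have h1 := (hH _ hz.2).comp_add_const z (2 * Real.pi * I)
      refine (h1.sub (hH _ hz.1)).congr_deriv ?_
      simp [hΨ, logParam, exp_periodic z]
    refine hUo.is_const_of_deriv_eq_zero (f := fun z => H (z + 2 * Real.pi * I) - H z)
      hUc.isPreconnected
      (fun z hz => (hd z hz).differentiableAt.differentiableWithinAt)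
      (fun z hz => (hd z hz).deriv) ⟨hζB 0 (by simp), ?_⟩ ⟨hcB 0 ⟨le_rfl, hpi.le⟩, ?_⟩
    · have := hζB 1 (by simp)
      rw [hper] at this
      exact this
    · have := hcB (2 * Real.pi) ⟨hpi.le, le_rfl⟩
      simpa [hc] using this
  rw [e1, hper, e3, ← e2]
  congr 2
  simp [hc]

/-- On the line `Re ζ = 0` the real `k` sits at `ζ = iθ` with `θ = π + 2 arctan k`. The excluded
ends `θ = 0, 2π` correspond to `k = ∓∞`. -/
theorem exp_pi_add_two_arctan (k : ℝ) :
    exp (((Real.pi + 2 * Real.arctan k : ℝ) : ℂ) * I) = ((k : ℂ) - I) / (k + I) := by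
  have h0 : (0 : ℝ) < 1 + k ^ 2 := by positivity
  have hs : Real.sqrt (1 + k ^ 2) ≠ 0 := (Real.sqrt_pos.2 h0).ne'
  have hs' : ((Real.sqrt (1 + k ^ 2) : ℝ) : ℂ) ≠ 0 := by exact_mod_cast hs
  have hsq : ((Real.sqrt (1 + k ^ 2) : ℝ) : ℂ) ^ 2 = (1 + I * k) * (1 - I * k) := by
    rw [← ofReal_pow, Real.sq_sqrt h0.le]
    push_cast
    linear_combination (k : ℂ) ^ 2 * I_sq
  have h1 : exp ((Real.arctan k : ℂ) * I) = (1 + I * k) / (Real.sqrt (1 + k ^ 2) : ℝ) := by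
    rw [exp_mul_I, ← ofReal_cos, ← ofReal_sin, Real.cos_arctan, Real.sin_arctan]
    push_cast
    field_simp
  have hne : (1 - I * k : ℂ) ≠ 0 := fun h => by
    have := congrArg Complex.re h
    simp at this
  have hne2 : (1 + I * k : ℂ) ≠ 0 := fun h => by
    have := congrArg Complex.re h
    simp at this
  have hkI : (k + I : ℂ) ≠ 0 := fun h => by
    have := congrArg Complex.im h
    simp at this
  rw [show (((Real.pi + 2 * Real.arctan k : ℝ) : ℂ) * I)
      = Real.pi * I + ((Real.arctan k : ℂ) * I + (Real.arctan k : ℂ) * I) by push_cast; ring,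
    exp_add, exp_add, h1, exp_pi_mul_I, div_mul_div_comm, ← sq (Real.sqrt _ : ℂ), hsq]
  field_simp
  linear_combination (-2 * (k : ℂ)) * I_sq

theorem exp_angle_ne_one (k : ℝ) :
    exp (((Real.pi + 2 * Real.arctan k : ℝ) : ℂ) * I) ≠ 1 := by
  have hkI : (k + I : ℂ) ≠ 0 := fun h => by
    have := congrArg Complex.im h
    simp at this
  rw [exp_pi_add_two_arctan, ne_eq, div_eq_one_iff_eq hkI]
  intro h
  have := congrArg Complex.im h
  norm_num at this

theorem image_pi_add_two_arctan :
    (fun k => Real.pi + 2 * Real.arctan k) '' univ = Ioo 0 (2 * Real.pi) := by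
  ext θ
  constructor
  · rintro ⟨k, -, rfl⟩
    have := Real.arctan_lt_pi_div_two k
    have := Real.neg_pi_div_two_lt_arctan k
    constructor <;> simp only <;> linarith
  · rintro ⟨h1, h2⟩
    refine ⟨Real.tan ((θ - Real.pi) / 2), mem_univ _, ?_⟩
    simp only
    rw [Real.arctan_tan (by linarith) (by linarith)]
    ring

/-- Substitution `θ = π + 2 arctan k`; the Jacobian `2/(1 + k²)` absorbs the factor `1/2`. -/
theorem integral_logParam_circle (Φ : ℂ → ℂ) :
    ∫ θ in (0 : ℝ)..2 * Real.pi, 1 / 2 * Φ (logParam (θ * I)) =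
      ∫ k : ℝ, Φ k / (1 + (k : ℂ) ^ 2) := by
  rw [intervalIntegral.integral_of_le Real.two_pi_pos.le, integral_Ioc_eq_integral_Ioo,
    ← image_pi_add_two_arctan, integral_image_eq_integral_abs_deriv_smul
      (f' := fun k => 2 * (1 / (1 + k ^ 2))) MeasurableSet.univ
      (fun k _ => (((Real.hasDerivAt_arctan k).const_mul 2).const_add _).hasDerivWithinAt)
      (fun a _ b _ h => Real.arctan_injective (by simpa using h)), setIntegral_univ]
  refine integral_congr_ae (Eventually.of_forall fun k => ?_)
  have hkI : (k + I : ℂ) ≠ 0 := fun h => by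
    have := congrArg Complex.im h
    simp at this
  simp only
  rw [logParam_of_exp_eq hkI (exp_pi_add_two_arctan k), abs_of_pos (by positivity), real_smul]
  push_cast
  ring

/-- The integral of `Φ(k) / (1 + k²)` around `i` equals the integral over the real line. -/
theorem IsContourAroundI.contourIntegral_eq_integral {γ : ℝ → ℂ} (hγ : IsContourAroundI γ)
    {Φ : ℂ → ℂ} (hΦ : DifferentiableOn ℂ Φ ({I, -I} : Set ℂ)ᶜ) {M : ℝ}
    (hM : ∀ k : ℂ, 0 ≤ k.im → ‖k + I‖ ≤ 3 * ‖k - I‖ → ‖Φ k‖ ≤ M) :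
    contourIntegral γ (fun k => Φ k / (1 + k ^ 2)) = ∫ k : ℝ, Φ k / (1 + (k : ℂ) ^ 2) := by
  rw [← integral_logParam_circle]
  have hcontAt : ∀ {z : ℂ}, exp z ≠ 1 → ContinuousAt (fun z => 1 / 2 * Φ (logParam z)) z := by
    intro z h1
    have h2 : DifferentiableAt ℂ Φ (logParam z) :=
      hΦ.differentiableAt (isOpen_compl_I_neg_I.mem_nhds (logParam_mem_compl h1))
    exact continuousAt_const.mul (ContinuousAt.comp h2.continuousAt
      (differentiableAt_logParam h1).continuousAt)
  have hlim : Tendsto (fun δ : ℝ => ∫ θ in (0 : ℝ)..2 * Real.pi,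
      1 / 2 * Φ (logParam (-δ + θ * I))) (𝓝[>] 0)
      (𝓝 (∫ θ in (0 : ℝ)..2 * Real.pi, 1 / 2 * Φ (logParam (θ * I)))) := by
    refine intervalIntegral.tendsto_integral_filter_of_dominated_convergence (fun _ => M) ?_ ?_
      (by simp) ?_
    · filter_upwards [self_mem_nhdsWithin] with δ hδ
      refine Continuous.aestronglyMeasurable (continuous_iff_continuousAt.2 fun θ => ?_)
      have h1 : exp (-(δ : ℂ) + θ * I) ≠ 1 := exp_ne_one_of_re_neg (by simpa using hδ)
      exact ContinuousAt.comp (f := fun θ : ℝ => -(δ : ℂ) + θ * I) (hcontAt h1) (by fun_prop)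
    · have hlt : ∀ᶠ δ : ℝ in 𝓝[>] 0, δ < 1 :=
        mem_nhdsWithin_of_mem_nhds (Iio_mem_nhds one_pos)
      filter_upwards [self_mem_nhdsWithin, hlt] with δ hδ hδ1
      refine Eventually.of_forall fun θ _ => ?_
      have hδ' : 0 < δ := hδ
      have hre : (-(δ : ℂ) + θ * I).re = -δ := by simp
      have h1 : exp (-(δ : ℂ) + θ * I) ≠ 1 := exp_ne_one_of_re_neg (by rw [hre]; linarith)
      have h2 := norm_logParam_sub_I h1
      rw [hre] at h2
      -- For `δ < 1` the ratio `|k - i|/|k + i| = e^{-δ}` exceeds `1/e > 1/3`; this is the origin of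
      -- the 3 in `hM`.
      have h3 : 1 / 3 ≤ Real.exp (-δ) := by
        rw [Real.exp_neg, ← one_div]
        refine one_div_le_one_div_of_le (Real.exp_pos _) ?_
        have h4 : Real.exp δ ≤ Real.exp 1 := Real.exp_le_exp.2 hδ1.le
        have := Real.exp_one_lt_three
        linarith
      have h5 := hM _ (logParam_im_nonneg h1 (by rw [hre]; linarith)) (by
        rw [h2]
        nlinarith [norm_nonneg (logParam (-(δ : ℂ) + θ * I) + I)])
      rw [norm_mul]
      have h6 : ‖(1 / 2 : ℂ)‖ = 1 / 2 := by norm_num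
      rw [h6]
      have := norm_nonneg (Φ (logParam (-(δ : ℂ) + θ * I)))
      linarith
    -- At `θ = 2π` the denominator of `logParam` vanishes; this single point is discarded.
    · have hae : ∀ᵐ θ : ℝ, θ ≠ 2 * Real.pi := by simp [ae_iff, measure_singleton]
      filter_upwards [hae] with θ hθ hmem
      rw [uIoc_of_le Real.two_pi_pos.le] at hmem
      have hθ' : θ ∈ Ioo 0 (2 * Real.pi) := ⟨hmem.1, lt_of_le_of_ne hmem.2 hθ⟩
      rw [← image_pi_add_two_arctan] at hθ'
      obtain ⟨k, -, hk⟩ := hθ'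
      have h1 : exp ((θ : ℂ) * I) ≠ 1 := by
        rw [← hk]
        exact exp_angle_ne_one k
      have h2 : Tendsto (fun δ : ℝ => -(δ : ℂ) + θ * I) (𝓝[>] 0) (𝓝 (θ * I)) := by
        have : ContinuousAt (fun δ : ℝ => -(δ : ℂ) + θ * I) 0 := by fun_prop
        have := this.tendsto
        simp only [ofReal_zero, neg_zero, zero_add] at this
        exact this.mono_left nhdsWithin_le_nhds
      exact (hcontAt h1).tendsto.comp h2
  refine tendsto_nhds_unique (tendsto_const_nhds.congr' ?_) hlim
  filter_upwards [self_mem_nhdsWithin] with δ hδ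
  exact hγ.contourIntegral_eq_circle hΦ hδ

/-! ### Improper integrals and Abel integrals -/

theorem _root_.MeasureTheory.Integrable.hasImproperIntegral {F : ℝ → ℂ} (hF : Integrable F) :
    HasImproperIntegral F (∫ k, F k) :=
  ⟨fun _ _ => hF.intervalIntegrable,
    intervalIntegral_tendsto_integral hF tendsto_fst tendsto_snd⟩

theorem HasImproperIntegral.add {F G : ℝ → ℂ} {L M : ℂ} (hF : HasImproperIntegral F L)
    (hG : HasImproperIntegral G M) : HasImproperIntegral (fun k => F k + G k) (L + M) := by
  refine ⟨fun a b => (hF.1 a b).add (hG.1 a b), (hF.2.add hG.2).congr fun p => ?_⟩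
  rw [intervalIntegral.integral_add (hF.1 _ _) (hG.1 _ _)]

theorem HasImproperIntegral.const_mul {F : ℝ → ℂ} {L : ℂ} (hF : HasImproperIntegral F L) (c : ℂ) :
    HasImproperIntegral (fun k => c * F k) (c * L) := by
  refine ⟨fun a b => (hF.1 a b).const_mul c, (hF.2.const_mul c).congr fun p => ?_⟩
  rw [intervalIntegral.integral_const_mul]

theorem HasImproperIntegral.sub {F G : ℝ → ℂ} {L M : ℂ} (hF : HasImproperIntegral F L)
    (hG : HasImproperIntegral G M) : HasImproperIntegral (fun k => F k - G k) (L - M) := by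
  simpa [sub_eq_add_neg] using hF.add (hG.const_mul (-1))

theorem HasAbelIntegral.add {F G : ℝ → ℂ} {L M : ℂ} (hF : HasAbelIntegral F L)
    (hG : HasAbelIntegral G M) : HasAbelIntegral (fun k => F k + G k) (L + M) := by
  refine ⟨fun ε hε => ?_, (hF.2.add hG.2).congr' ?_⟩
  · simp only [mul_add]
    exact (hF.1 ε hε).add (hG.1 ε hε)
  · filter_upwards [self_mem_nhdsWithin] with ε hε
    simp only [mul_add]
    rw [integral_add (hF.1 ε hε) (hG.1 ε hε)]

theorem HasAbelIntegral.const_mul {F : ℝ → ℂ} {L : ℂ} (hF : HasAbelIntegral F L) (c : ℂ) :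
    HasAbelIntegral (fun k => c * F k) (c * L) := by
  refine ⟨fun ε hε => ?_, (hF.2.const_mul c).congr fun ε => ?_⟩
  · simpa only [mul_left_comm] using (hF.1 ε hε).const_mul c
  · simp only [mul_left_comm _ c, integral_const_mul]

theorem HasAbelIntegral.sub {F G : ℝ → ℂ} {L M : ℂ} (hF : HasAbelIntegral F L)
    (hG : HasAbelIntegral G M) : HasAbelIntegral (fun k => F k - G k) (L - M) := by
  simpa [sub_eq_add_neg] using hF.add (hG.const_mul (-1))

theorem integrableOn_Ioi_exp_mul {f : ℝ → ℂ} (hf : Continuous f) {M : ℝ}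
    (hM : ∀ k, 0 ≤ k → ‖f k‖ ≤ M) {ε : ℝ} (hε : 0 < ε) :
    IntegrableOn (fun k => (Real.exp (-ε * k) : ℂ) * f k) (Ioi 0) := by
  refine Integrable.mono' ((exp_neg_integrableOn_Ioi 0 hε).mul_const M)
    (Continuous.aestronglyMeasurable (by fun_prop)) ?_
  refine (ae_restrict_iff' measurableSet_Ioi).2 (Eventually.of_forall fun k hk => ?_)
  rw [norm_mul, norm_real, Real.norm_eq_abs, Real.abs_exp]
  exact mul_le_mul_of_nonneg_left (hM k (le_of_lt hk)) (Real.exp_pos _).le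

/-- Folding the line onto `(0, ∞)` removes the absolute value from the weight. -/
theorem integrable_exp_abs_mul {F : ℝ → ℂ} (hF : Continuous F) {M : ℝ} (hM : ∀ k, ‖F k‖ ≤ M)
    {ε : ℝ} (hε : 0 < ε) :
    Integrable (fun k : ℝ => (Real.exp (-ε * |k|) : ℂ) * F k) ∧
    ∫ k : ℝ, (Real.exp (-ε * |k|) : ℂ) * F k =
      ∫ k in Ioi (0 : ℝ), (Real.exp (-ε * k) : ℂ) * (F k + F (-k)) := by
  have h1 : IntegrableOn (fun k : ℝ => (Real.exp (-ε * k) : ℂ) * F k) (Ioi 0) :=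
    integrableOn_Ioi_exp_mul hF (fun k _ => hM k) hε
  have h2 : IntegrableOn (fun k : ℝ => (Real.exp (-ε * k) : ℂ) * F (-k)) (Ioi 0) :=
    integrableOn_Ioi_exp_mul (f := fun k => F (-k)) (by fun_prop) (fun k _ => hM _) hε
  have h1' : IntegrableOn (fun k : ℝ => (Real.exp (-ε * |k|) : ℂ) * F k) (Ioi 0) :=
    h1.congr_fun (fun k hk => by simp only [abs_of_pos (show 0 < k from hk)]) measurableSet_Ioi
  have h2' : IntegrableOn (fun k : ℝ => (Real.exp (-ε * |-k|) : ℂ) * F (-k)) (Ioi 0) :=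
    h2.congr_fun (fun k hk => by simp only [abs_neg, abs_of_pos (show 0 < k from hk)])
      measurableSet_Ioi
  have h3 : IntegrableOn (fun k : ℝ => (Real.exp (-ε * |k|) : ℂ) * F k) (Iic 0) := by
    have h4 : IntegrableOn (fun k : ℝ => (Real.exp (-ε * |-k|) : ℂ) * F (-k)) (Ioi (-0)) := by
      rwa [neg_zero]
    have h5 := h4.comp_neg_Iio
    simp only [neg_neg] at h5
    rwa [integrableOn_Iic_iff_integrableOn_Iio]
  have hint := h3.union h1'
  rw [Iic_union_Ioi, integrableOn_univ] at hint
  refine ⟨hint, ?_⟩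
  rw [← intervalIntegral.integral_Iic_add_Ioi h3 h1']
  have e1 := integral_comp_neg_Ioi 0 (fun k : ℝ => (Real.exp (-ε * |k|) : ℂ) * F k)
  rw [neg_zero] at e1
  rw [← e1, add_comm, ← integral_add h1' h2']
  refine setIntegral_congr_fun measurableSet_Ioi fun k hk => ?_
  simp only [abs_neg, abs_of_pos (show 0 < k from hk)]
  ring

/-- Abel's theorem: a convergent improper integral is summed by the Abel method. -/
theorem HasImproperIntegral.hasAbelIntegral {F : ℝ → ℂ} {L : ℂ} (h : HasImproperIntegral F L)
    (hF : Continuous F) {M : ℝ} (hM : ∀ k, ‖F k‖ ≤ M) : HasAbelIntegral F L := by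
  refine ⟨fun ε hε => (integrable_exp_abs_mul hF hM hε).1, ?_⟩
  set Ψ : ℝ → ℂ := fun k => ∫ u in -k..k, F u with hΨ
  have hΨ' : ∀ k, Ψ k = (∫ u in (0 : ℝ)..k, F u) - ∫ u in (0 : ℝ)..-k, F u := fun k =>
    (intervalIntegral.integral_interval_sub_left (hF.intervalIntegrable _ _)
      (hF.intervalIntegrable _ _)).symm
  have hprim : ∀ k, HasDerivAt (fun k => ∫ u in (0 : ℝ)..k, F u) (F k) k := fun k =>
    intervalIntegral.integral_hasDerivAt_right (hF.intervalIntegrable _ _)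
      hF.stronglyMeasurable.stronglyMeasurableAtFilter hF.continuousAt
  have hd : ∀ k, HasDerivAt Ψ (F k + F (-k)) k := by
    intro k
    have h1 : HasDerivAt (fun k : ℝ => ∫ u in (0 : ℝ)..-k, F u) (-F (-k)) k := by
      simpa [Function.comp_def] using (hprim (-k)).scomp k (hasDerivAt_neg k)
    have h2 := (hprim k).sub h1
    rw [sub_neg_eq_add] at h2
    exact h2.congr_of_eventuallyEq (Eventually.of_forall fun k => hΨ' k)
  have hΨc : Continuous Ψ := continuous_iff_continuousAt.2 fun k => (hd k).continuousAt
  have hΨ0 : Ψ 0 = 0 := by simp [hΨ]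
  have hlim : Tendsto Ψ atTop (𝓝 L) :=
    h.2.comp (tendsto_neg_atTop_atBot.prodMk tendsto_id)
  obtain ⟨C, hC⟩ : ∃ C, ∀ k, 0 ≤ k → ‖Ψ k‖ ≤ C := by
    obtain ⟨N, hN⟩ := eventually_atTop.1 (hlim.norm.eventually_le_const (lt_add_one ‖L‖))
    obtain ⟨C, hC⟩ := (isCompact_Icc (a := (0 : ℝ)) (b := N)).exists_bound_of_continuousOn
      hΨc.continuousOn
    refine ⟨max C (‖L‖ + 1), fun k hk => ?_⟩
    rcases le_total k N with hkN | hkN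
    · exact (hC k ⟨hk, hkN⟩).trans (le_max_left _ _)
    · exact (hN k hkN).trans (le_max_right _ _)
  -- Integration by parts turns the weighted integral into `ε ∫ e^{-εk} Ψ(k) dk`, and `u = εk` moves
  -- `ε` into the argument of `Ψ`, where dominated convergence applies.
  have key : ∀ ε : ℝ, 0 < ε → ∫ k : ℝ, (Real.exp (-ε * |k|) : ℂ) * F k =
      ∫ u in Ioi (0 : ℝ), (Real.exp (-u) : ℂ) * Ψ (ε⁻¹ * u) := by
    intro ε hε
    rw [(integrable_exp_abs_mul hF hM hε).2]
    have i1 : IntegrableOn (fun k : ℝ => (Real.exp (-ε * k) : ℂ) * (F k + F (-k))) (Ioi 0) :=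
      integrableOn_Ioi_exp_mul (f := fun k => F k + F (-k)) (by fun_prop)
        (fun k _ => (norm_add_le _ _).trans (add_le_add (hM k) (hM (-k)))) hε
    have i2 : IntegrableOn (fun k : ℝ => (Real.exp (-ε * k) : ℂ) * Ψ k) (Ioi 0) :=
      integrableOn_Ioi_exp_mul hΨc hC hε
    have hexp : ∀ k : ℝ, HasDerivAt (fun k : ℝ => (Real.exp (-ε * k) : ℂ))
        ((Real.exp (-ε * k) : ℂ) * (-ε : ℝ)) k := by
      intro k
      have := (((hasDerivAt_id k).const_mul (-ε)).exp).ofReal_comp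
      simpa using this
    have hder : ∀ k ∈ Ici (0 : ℝ), HasDerivAt (fun k : ℝ => (Real.exp (-ε * k) : ℂ) * Ψ k)
        ((Real.exp (-ε * k) : ℂ) * (F k + F (-k)) - ε * ((Real.exp (-ε * k) : ℂ) * Ψ k)) k := by
      intro k _
      refine ((hexp k).mul (hd k)).congr_deriv ?_
      push_cast
      ring
    have hz : Tendsto (fun k : ℝ => (Real.exp (-ε * k) : ℂ) * Ψ k) atTop (𝓝 0) := by
      have h1 : Tendsto (fun k : ℝ => Real.exp (-ε * k)) atTop (𝓝 0) := by
        refine Real.tendsto_exp_atBot.comp ?_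
        exact tendsto_id.const_mul_atTop_of_neg (neg_neg_of_pos hε)
      have h2 : Tendsto (fun k : ℝ => (Real.exp (-ε * k) : ℂ)) atTop (𝓝 0) := by
        exact (continuous_ofReal.tendsto 0).comp h1
      simpa using h2.mul hlim
    have hI := integral_Ioi_of_hasDerivAt_of_tendsto' hder (i1.sub (i2.const_mul _)) hz
    rw [integral_sub i1 (i2.const_mul _), integral_const_mul, hΨ0, mul_zero, sub_zero,
      sub_eq_zero] at hI
    rw [hI]
    have hs := integral_comp_mul_left_Ioi (fun u : ℝ => (Real.exp (-u) : ℂ) * Ψ (ε⁻¹ * u)) 0 hε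
    rw [mul_zero] at hs
    have hs' : ∫ k in Ioi (0 : ℝ), (Real.exp (-ε * k) : ℂ) * Ψ k =
        ε⁻¹ • ∫ u in Ioi (0 : ℝ), (Real.exp (-u) : ℂ) * Ψ (ε⁻¹ * u) := by
      rw [← hs]
      refine setIntegral_congr_fun measurableSet_Ioi fun k _ => ?_
      simp only [neg_mul, inv_mul_cancel_left₀ hε.ne']
    rw [hs', real_smul, ofReal_inv, mul_inv_cancel_left₀ (by exact_mod_cast hε.ne')]
  have hlim2 : Tendsto (fun ε : ℝ => ∫ u in Ioi (0 : ℝ), (Real.exp (-u) : ℂ) * Ψ (ε⁻¹ * u))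
      (𝓝[>] 0) (𝓝 (∫ u in Ioi (0 : ℝ), (Real.exp (-u) : ℂ) * L)) := by
    have hexpi : IntegrableOn (fun u : ℝ => Real.exp (-u)) (Ioi 0) := by
      simpa using exp_neg_integrableOn_Ioi 0 one_pos
    refine tendsto_integral_filter_of_dominated_convergence (fun u => Real.exp (-u) * C) ?_ ?_
      (hexpi.mul_const C) ?_
    · exact Eventually.of_forall fun ε => Continuous.aestronglyMeasurable (by fun_prop)
    · filter_upwards [self_mem_nhdsWithin] with ε hε
      refine (ae_restrict_iff' measurableSet_Ioi).2 (Eventually.of_forall fun u hu => ?_)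
      rw [norm_mul, norm_real, Real.norm_eq_abs, Real.abs_exp]
      exact mul_le_mul_of_nonneg_left (hC _ (mul_nonneg (inv_nonneg.2 (le_of_lt hε)) (le_of_lt hu)))
        (Real.exp_pos _).le
    · refine (ae_restrict_iff' measurableSet_Ioi).2 (Eventually.of_forall fun u hu => ?_)
      refine Tendsto.const_mul _ (hlim.comp ?_)
      exact tendsto_inv_nhdsGT_zero.atTop_mul_const hu
  have hval : ∫ u in Ioi (0 : ℝ), (Real.exp (-u) : ℂ) * L = L := by
    rw [integral_mul_const, integral_complex_ofReal, integral_exp_neg_Ioi_zero, ofReal_one, one_mul]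
  rw [hval] at hlim2
  refine hlim2.congr' ?_
  filter_upwards [self_mem_nhdsWithin] with ε hε
  exact (key ε hε).symm

theorem norm_exp_I_mul_ofReal_mul (k x : ℝ) : ‖exp (I * k * x)‖ = 1 := by
  rw [show I * k * x = ((k * x : ℝ) : ℂ) * I by push_cast; ring, norm_exp_ofReal_mul_I]

/-- The two half-lines contribute `1/(ε - ix)` and `1/(ε + ix)`. Their sum is the Poisson kernel
`2ε/(ε² + x²)`, which tends to 0 away from `x = 0`. -/
theorem hasAbelIntegral_exp {x : ℝ} (hx : x ≠ 0) :
    HasAbelIntegral (fun k : ℝ => exp (I * k * x)) 0 := by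
  have hc : Continuous fun k : ℝ => exp (I * k * x) := by fun_prop
  have hM : ∀ k : ℝ, ‖exp (I * k * x)‖ ≤ 1 := fun k => (norm_exp_I_mul_ofReal_mul k x).le
  refine ⟨fun ε hε => (integrable_exp_abs_mul hc hM hε).1, ?_⟩
  have hIx : I * (x : ℂ) ≠ 0 := mul_ne_zero I_ne_zero (by exact_mod_cast hx)
  have hval : ∀ ε : ℝ, 0 < ε → ∫ k : ℝ, (Real.exp (-ε * |k|) : ℂ) * exp (I * k * x) =
      -1 / (-ε + I * x) + -1 / (-ε - I * x) := by
    intro ε hε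
    rw [(integrable_exp_abs_mul hc hM hε).2]
    have h1 : (-(ε : ℂ) + I * x).re < 0 := by simp [hε]
    have h2 : (-(ε : ℂ) - I * x).re < 0 := by simp [hε]
    have e1 := integral_exp_mul_complex_Ioi h1 0
    have e2 := integral_exp_mul_complex_Ioi h2 0
    simp only [ofReal_zero, mul_zero, exp_zero] at e1 e2
    rw [← e1, ← e2, ← integral_add (integrableOn_exp_mul_complex_Ioi h1 0)
      (integrableOn_exp_mul_complex_Ioi h2 0)]
    refine integral_congr_ae (Eventually.of_forall fun k => ?_)
    simp only
    rw [ofReal_exp, mul_add, ← exp_add, ← exp_add]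
    congr 2 <;> · push_cast; ring
  have hlim : Tendsto (fun ε : ℝ => -1 / (-(ε : ℂ) + I * x) + -1 / (-(ε : ℂ) - I * x)) (𝓝[>] 0)
      (𝓝 0) := by
    have hcont : ContinuousAt
        (fun ε : ℝ => -1 / (-(ε : ℂ) + I * x) + -1 / (-(ε : ℂ) - I * x)) 0 := by
      refine ContinuousAt.add (ContinuousAt.div (by fun_prop) (by fun_prop) (by simpa using hIx))
        (ContinuousAt.div (by fun_prop) (by fun_prop) (by simpa using hIx))
    have := hcont.tendsto
    simp only [ofReal_zero, neg_zero, zero_add, zero_sub, div_neg, add_neg_cancel] at this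
    exact this.mono_left nhdsWithin_le_nhds
  refine hlim.congr' ?_
  filter_upwards [self_mem_nhdsWithin] with ε hε
  exact (hval ε hε).symm

/-! ### Fourier integrals of the boundary terms -/

theorem one_add_I_mul_ofReal_ne_zero (k : ℝ) : 1 + I * (k : ℂ) ≠ 0 := fun h => by
  have := congrArg Complex.re h
  simp at this

theorem one_add_ofReal_sq_ne_zero (k : ℝ) : 1 + (k : ℂ) ^ 2 ≠ 0 := by
  have : (1 + k ^ 2 : ℝ) ≠ 0 := by positivity
  exact_mod_cast this

theorem one_add_sq_ne_zero {k : ℂ} (h : k ∈ ({I, -I} : Set ℂ)ᶜ) : 1 + k ^ 2 ≠ 0 := by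
  simp only [mem_compl_iff, mem_insert_iff, mem_singleton_iff, not_or] at h
  rw [show 1 + k ^ 2 = (k - I) * (k + I) by linear_combination I_sq]
  exact mul_ne_zero (sub_ne_zero.2 h.1) fun h' => h.2 (eq_neg_of_add_eq_zero_left h')

theorem one_add_I_mul_ne_zero {k : ℂ} (h : k ≠ I) : 1 + I * k ≠ 0 := by
  rw [show 1 + I * k = I * (k - I) by linear_combination I_sq]
  exact mul_ne_zero I_ne_zero (sub_ne_zero.2 h)

theorem ofReal_mem_compl (k : ℝ) : (k : ℂ) ∈ ({I, -I} : Set ℂ)ᶜ := by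
  simp only [mem_compl_iff, mem_insert_iff, mem_singleton_iff, not_or]
  constructor <;> intro h <;> have := congrArg Complex.im h <;> simp at this

theorem norm_ofReal_add_I (k : ℝ) : ‖(k : ℂ) + I‖ ≤ 3 * ‖(k : ℂ) - I‖ := by
  have : ‖(k : ℂ) + I‖ = ‖(k : ℂ) - I‖ := by
    rw [← sq_eq_sq₀ (norm_nonneg _) (norm_nonneg _), Complex.sq_norm, Complex.sq_norm,
      normSq_apply, normSq_apply]
    simp
  have := norm_nonneg ((k : ℂ) - I)
  linarith

theorem norm_exp_I_mul_le_one {k : ℂ} (hk : 0 ≤ k.im) {x : ℝ} (hx : 0 ≤ x) :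
    ‖exp (I * k * x)‖ ≤ 1 := by
  rw [norm_exp, Real.exp_le_one_iff]
  simp
  positivity

theorem integrable_div_one_add_sq {Φ : ℝ → ℂ} (hΦ : Continuous Φ) {M : ℝ} (hM : ∀ k, ‖Φ k‖ ≤ M) :
    Integrable fun k : ℝ => Φ k / (1 + (k : ℂ) ^ 2) := by
  refine Integrable.mono' (integrable_inv_one_add_sq.const_mul M)
    (Continuous.aestronglyMeasurable (hΦ.div (by fun_prop) one_add_ofReal_sq_ne_zero)) ?_
  refine Eventually.of_forall fun k => ?_
  rw [norm_div, div_eq_mul_inv]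
  have : ‖1 + (k : ℂ) ^ 2‖ = 1 + k ^ 2 := by
    rw [show 1 + (k : ℂ) ^ 2 = ((1 + k ^ 2 : ℝ) : ℂ) by push_cast; ring, norm_real,
      Real.norm_of_nonneg (by positivity)]
  rw [this]
  exact mul_le_mul_of_nonneg_right (hM k) (by positivity)

/-- Integration by parts for `e^{ikx} / (1 + ik)`. -/
theorem hasDerivAt_exp_div {x : ℝ} (hx : x ≠ 0) {k : ℂ} (hk : k ≠ I) :
    HasDerivAt (fun k => exp (I * k * x) / (I * x * (1 + I * k)))
      (exp (I * k * x) / (1 + I * k) - 1 / x * (exp (I * k * x) / (1 + I * k) ^ 2)) k := by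
  have hxc : (x : ℂ) ≠ 0 := by exact_mod_cast hx
  have h1 := one_add_I_mul_ne_zero hk
  have hI := I_ne_zero
  have hd1 : HasDerivAt (fun k : ℂ => I * k * x) (I * x) k := by
    simpa using ((hasDerivAt_id k).const_mul I).mul_const (x : ℂ)
  have hd2 : HasDerivAt (fun k : ℂ => I * x * (1 + I * k)) (I * x * I) k := by
    simpa using (((hasDerivAt_id k).const_mul I).const_add 1).const_mul (I * (x : ℂ))
  refine (hd1.cexp.div hd2 (mul_ne_zero (mul_ne_zero hI hxc) h1)).congr_deriv ?_
  field_simp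

/-- The integrand decays only like `1/k`. One integration by parts gains a power of `k` at the price
of `1/x`, and the boundary terms vanish at each end separately. -/
theorem hasImproperIntegral_exp_div {x : ℝ} (hx : 0 < x) :
    HasImproperIntegral (fun k : ℝ => exp (I * k * x) / (1 + I * k))
      (1 / x * ∫ k : ℝ, exp (I * k * x) / (1 + I * k) ^ 2) := by
  have hne := one_add_I_mul_ofReal_ne_zero
  have hc1 : Continuous fun k : ℝ => exp (I * k * x) / (1 + I * k) :=
    Continuous.div (by fun_prop) (by fun_prop) hne
  have hc2 : Continuous fun k : ℝ => exp (I * k * x) / (1 + I * k) ^ 2 :=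
    Continuous.div (by fun_prop) (by fun_prop) fun k => pow_ne_zero 2 (hne k)
  have hc3 : Continuous fun k : ℝ => 1 / (x : ℂ) * (exp (I * k * x) / (1 + I * k) ^ 2) :=
    continuous_const.mul hc2
  have hint : Integrable fun k : ℝ => exp (I * k * x) / (1 + I * k) ^ 2 := by
    refine Integrable.mono' integrable_inv_one_add_sq hc2.aestronglyMeasurable
      (Eventually.of_forall fun k => ?_)
    rw [norm_div, norm_exp_I_mul_ofReal_mul, norm_pow, Complex.sq_norm, normSq_apply]
    simp [sq]
  refine ⟨fun a b => hc1.intervalIntegrable a b, ?_⟩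
  have hG : ∀ a b : ℝ, ∫ k in a..b, exp (I * k * x) / (1 + I * k) =
      (exp (I * b * x) / (I * x * (1 + I * b)) - exp (I * a * x) / (I * x * (1 + I * a))) +
        1 / x * ∫ k in a..b, exp (I * k * x) / (1 + I * k) ^ 2 := by
    intro a b
    have h := intervalIntegral.integral_eq_sub_of_hasDerivAt (a := a) (b := b)
      (f := fun k : ℝ => exp (I * k * x) / (I * x * (1 + I * k)))
      (fun k _ => (hasDerivAt_exp_div hx.ne' (k := (k : ℂ)) (fun h => by
        have := congrArg Complex.im h
        simp at this)).comp_ofReal)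
      ((hc1.sub hc3).intervalIntegrable a b)
    rw [intervalIntegral.integral_sub (hc1.intervalIntegrable a b) (hc3.intervalIntegrable a b),
      intervalIntegral.integral_const_mul] at h
    rw [← h]
    ring
  have hz : ∀ l : Filter ℝ, Tendsto (fun k : ℝ => |k|) l atTop →
      Tendsto (fun k : ℝ => exp (I * k * x) / (I * x * (1 + I * k))) l (𝓝 0) := by
    intro l hl
    have hb : Tendsto (fun k : ℝ => x⁻¹ * |k|⁻¹) l (𝓝 0) := by
      simpa using (tendsto_inv_atTop_zero.comp hl).const_mul x⁻¹
    refine squeeze_zero_norm' ?_ hb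
    filter_upwards [hl.eventually_gt_atTop 0] with k hk
    rw [norm_div, norm_exp_I_mul_ofReal_mul, norm_mul, norm_mul, norm_I, norm_real,
      Real.norm_of_nonneg hx.le, one_mul, one_div, mul_inv]
    refine mul_le_mul_of_nonneg_left (inv_anti₀ hk ?_) (by positivity)
    simpa using abs_im_le_norm (1 + I * (k : ℂ))
  have hfst : Tendsto (fun p : ℝ × ℝ => p.1) (atBot ×ˢ atTop) atBot := tendsto_fst
  have hsnd : Tendsto (fun p : ℝ × ℝ => p.2) (atBot ×ˢ atTop) atTop := tendsto_snd
  have hlim := (((hz atTop tendsto_abs_atTop_atTop).comp hsnd).sub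
    ((hz atBot tendsto_abs_atBot_atTop).comp hfst)).add
    ((intervalIntegral_tendsto_integral hint hfst hsnd).const_mul (1 / (x : ℂ)))
  simp only [sub_zero, zero_add] at hlim
  exact hlim.congr fun p => (hG p.1 p.2).symm

/-- The same integration by parts leaves no boundary term on a closed curve. The remaining integrand
equals `Φ/(1 + k²)` with `Φ = e^{ikx}(1 - ik)/(1 + ik)`, to which the deformation applies; `|Φ| ≤ 3`
because `|k + i| ≤ 3|k - i|`. -/
theorem IsContourAroundI.contourIntegral_exp_div {γ : ℝ → ℂ} (hγ : IsContourAroundI γ) {x : ℝ}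
    (hx : 0 < x) :
    contourIntegral γ (fun k => exp (I * k * x) / (1 + I * k)) =
      1 / x * ∫ k : ℝ, exp (I * k * x) / (1 + I * k) ^ 2 := by
  have hc1 : ContinuousOn (fun k : ℂ => exp (I * k * x) / (1 + I * k)) ({k | 0 < k.im} \ {I}) :=
    ContinuousOn.div (by fun_prop) (by fun_prop) fun k hk => one_add_I_mul_ne_zero hk.2
  have hc2 : ContinuousOn (fun k : ℂ => 1 / x * (exp (I * k * x) / (1 + I * k) ^ 2))
      ({k | 0 < k.im} \ {I}) :=
    continuousOn_const.mul (ContinuousOn.div (by fun_prop) (by fun_prop)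
      fun k hk => pow_ne_zero 2 (one_add_I_mul_ne_zero hk.2))
  have h0 := hγ.contourIntegral_eq_zero_of_hasDerivAt
    (F := fun k => exp (I * k * x) / (1 + I * k) - 1 / x * (exp (I * k * x) / (1 + I * k) ^ 2))
    ((hc1.sub hc2).comp hγ.continuousOn fun s hs => ⟨hγ.upper s hs, hγ.avoids s hs⟩)
    (fun s hs => hasDerivAt_exp_div hx.ne' (hγ.avoids s hs))
  have h1 := hγ.contourIntegral_eq_integral
    (Φ := fun k => exp (I * k * x) * ((1 - I * k) / (1 + I * k))) (M := 3) ?_ ?_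
  · have e1 : contourIntegral γ (fun k => exp (I * k * x) * ((1 - I * k) / (1 + I * k)) /
        (1 + k ^ 2)) = contourIntegral γ (fun k => exp (I * k * x) / (1 + I * k) ^ 2) := by
      refine intervalIntegral.integral_congr fun s hs => ?_
      rw [uIcc_of_le zero_le_one] at hs
      have hk := upper_sdiff_subset_compl ⟨hγ.upper s hs, hγ.avoids s hs⟩
      have a1 := one_add_sq_ne_zero hk
      have a2 := one_add_I_mul_ne_zero (hγ.avoids s hs)
      simp only
      congr 1
      field_simp
      linear_combination (-γ s ^ 2) * I_sq
    have e2 : ∫ k : ℝ, exp (I * k * x) * ((1 - I * k) / (1 + I * k)) / (1 + (k : ℂ) ^ 2) =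
        ∫ k : ℝ, exp (I * k * x) / (1 + I * k) ^ 2 := by
      refine integral_congr_ae (Eventually.of_forall fun k => ?_)
      have a1 := one_add_ofReal_sq_ne_zero k
      have a2 := one_add_I_mul_ofReal_ne_zero k
      simp only
      field_simp
      linear_combination (-(k : ℂ) ^ 2) * I_sq
    rw [e1, e2] at h1
    rw [← h1]
    unfold contourIntegral at h0 ⊢
    simp only [sub_mul] at h0
    rw [intervalIntegral.integral_sub (hγ.intervalIntegrable_comp hc1)
      (hγ.intervalIntegrable_comp hc2), sub_eq_zero] at h0
    rw [h0, ← intervalIntegral.integral_const_mul]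
    simp only [mul_assoc]
  · intro k hk
    have hkI : k ≠ I := fun h => hk (by simp [h])
    have := one_add_I_mul_ne_zero hkI
    exact DifferentiableAt.differentiableWithinAt (by fun_prop (disch := assumption))
  · intro k hk hk3
    rw [norm_mul]
    have h1 : ‖(1 - I * k) / (1 + I * k)‖ ≤ 3 := by
      rw [show 1 - I * k = -(I * (k + I)) by linear_combination I_sq,
        show 1 + I * k = I * (k - I) by linear_combination I_sq, norm_div, norm_neg, norm_mul,
        norm_mul, norm_I, one_mul, one_mul]
      exact div_le_of_le_mul₀ (norm_nonneg _) (by norm_num) hk3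
    exact (mul_le_of_le_one_left (norm_nonneg _) (norm_exp_I_mul_le_one hk hx.le)).trans h1

/-- The point 1 is the value of `ω²` at `k = ∞`. Since `ω² - 1 = -1/(1 + k²)`, splitting off the
value there gains two powers of decay. -/
theorem exists_differentiable_eq_add_mul {A : ℂ → ℂ} (hA : Differentiable ℂ A) :
    ∃ A₁ : ℂ → ℂ, Differentiable ℂ A₁ ∧ ∀ z, A z = A 1 + (z - 1) * A₁ z := by
  refine ⟨dslope A 1, ?_, fun z => ?_⟩
  · rw [← differentiableOn_univ] at hA ⊢
    exact (differentiableOn_dslope univ_mem).2 hA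
  · have := sub_smul_dslope A 1 z
    rw [smul_eq_mul] at this
    rw [this]
    ring

/-- `ω(k)² = k² / (1 + k²)`. -/
def omegaSq (k : ℂ) : ℂ := 1 - 1 / (1 + k ^ 2)

theorem differentiableAt_omegaSq {k : ℂ} (hk : k ∈ ({I, -I} : Set ℂ)ᶜ) :
    DifferentiableAt ℂ omegaSq k := by
  have := one_add_sq_ne_zero hk
  unfold omegaSq
  fun_prop (disch := assumption)

/-- This is the region swept out by the deformation: it stays away from `±i`, so the coefficients
are bounded on it. -/
theorem one_third_le_norm_one_add_sq {k : ℂ} (hk : 0 ≤ k.im) (h3 : ‖k + I‖ ≤ 3 * ‖k - I‖) :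
    1 / 3 * ‖k + I‖ ^ 2 ≤ ‖1 + k ^ 2‖ ∧ 1 ≤ ‖k + I‖ := by
  constructor
  · rw [show 1 + k ^ 2 = (k - I) * (k + I) by linear_combination I_sq, norm_mul]
    nlinarith [norm_nonneg (k + I)]
  · have := abs_im_le_norm (k + I)
    rw [add_im, I_im, abs_of_nonneg (by linarith)] at this
    linarith

theorem exists_bound_comp_omegaSq {A : ℂ → ℂ} (hA : Continuous A) :
    ∃ M, ∀ k : ℂ, 0 ≤ k.im → ‖k + I‖ ≤ 3 * ‖k - I‖ → ‖A (omegaSq k)‖ ≤ M := by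
  -- Here `|ω² - 1| = 1/|1 + k²| ≤ 3`.
  obtain ⟨M, hM⟩ := (isCompact_closedBall (1 : ℂ) 3).exists_bound_of_continuousOn hA.continuousOn
  refine ⟨M, fun k hk h3 => hM _ ?_⟩
  obtain ⟨h1, h2⟩ := one_third_le_norm_one_add_sq hk h3
  have h4 : 1 / 3 ≤ ‖1 + k ^ 2‖ := by nlinarith
  rw [Metric.mem_closedBall, dist_eq_norm, omegaSq, sub_sub_cancel_left, norm_neg, norm_div,
    norm_one, div_le_iff₀ (by linarith)]
  linarith

theorem norm_mul_div_one_add_sq_le {k : ℂ} (hk : 0 ≤ k.im) (h3 : ‖k + I‖ ≤ 3 * ‖k - I‖) :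
    ‖I * k / (1 + k ^ 2)‖ ≤ 6 := by
  obtain ⟨h1, h2⟩ := one_third_le_norm_one_add_sq hk h3
  have h4 : ‖k‖ ≤ ‖k + I‖ + 1 := by
    have := norm_sub_le (k + I) I
    simpa using this
  rw [norm_div, norm_mul, norm_I, one_mul, div_le_iff₀ (by nlinarith)]
  nlinarith

/-- The general form of the boundary terms, in terms of entire functions of `ω²`. -/
def boundaryForm (A B E : ℂ → ℂ) (k : ℂ) : ℂ :=
  A (omegaSq k) - I * k / (1 + k ^ 2) * B (omegaSq k) + E (omegaSq k) / (1 + k ^ 2)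

theorem differentiableAt_boundaryForm {A B E : ℂ → ℂ} (hA : Differentiable ℂ A)
    (hB : Differentiable ℂ B) (hE : Differentiable ℂ E) {k : ℂ} (hk : k ∈ ({I, -I} : Set ℂ)ᶜ) :
    DifferentiableAt ℂ (boundaryForm A B E) k := by
  have h1 := one_add_sq_ne_zero hk
  have h2 := differentiableAt_omegaSq hk
  unfold boundaryForm
  fun_prop (disch := assumption)

/-- The Fourier integral over the real line of a boundary term is a contour integral around `i`. -/
theorem IsContourAroundI.hasImproperIntegral_boundaryForm {γ : ℝ → ℂ} (hγ : IsContourAroundI γ)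
    {A B E : ℂ → ℂ} (hA : Differentiable ℂ A) (hB : Differentiable ℂ B) (hE : Differentiable ℂ E)
    {x : ℝ} (hx : 0 < x) :
    HasImproperIntegral (fun k : ℝ => exp (I * k * x) * (boundaryForm A B E k - A 1))
      (contourIntegral γ fun k => exp (I * k * x) * boundaryForm A B E k) ∧
    (Continuous fun k : ℝ => exp (I * k * x) * (boundaryForm A B E k - A 1)) ∧
    ∃ M, ∀ k : ℝ, ‖exp (I * k * x) * (boundaryForm A B E k - A 1)‖ ≤ M := by
  obtain ⟨A₁, hA₁, hA₁'⟩ := exists_differentiable_eq_add_mul hA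
  obtain ⟨B₁, hB₁, hB₁'⟩ := exists_differentiable_eq_add_mul hB
  obtain ⟨ME, hME⟩ := exists_bound_comp_omegaSq hE.continuous
  obtain ⟨MA₁, hMA₁⟩ := exists_bound_comp_omegaSq hA₁.continuous
  obtain ⟨MB₁, hMB₁⟩ := exists_bound_comp_omegaSq hB₁.continuous
  have him : ∀ k : ℝ, 0 ≤ (k : ℂ).im := fun k => by simp
  -- What is left at order `k⁻²` after removing `A 1` and `B 1/(1 + ik)`. The term `-B 1` comes from
  -- `-ik/(1 + k²) = 1/(1 + ik) - 1/(1 + k²)`.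
  set Φ : ℂ → ℂ := fun k => exp (I * k * x) *
    (-A₁ (omegaSq k) + E (omegaSq k) - B 1 + I * k / (1 + k ^ 2) * B₁ (omegaSq k)) with hΦ
  have hsplit : ∀ k ∈ ({I, -I} : Set ℂ)ᶜ, exp (I * k * x) * (boundaryForm A B E k - A 1) =
      B 1 * (exp (I * k * x) / (1 + I * k)) + Φ k / (1 + k ^ 2) := by
    intro k hk
    have h1 := one_add_sq_ne_zero hk
    have h2 : 1 + I * k ≠ 0 := one_add_I_mul_ne_zero fun h => hk (by simp [h])
    have h3 : 1 / (1 + I * k) = (1 - I * k) / (1 + k ^ 2) := by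
      field_simp
      linear_combination k ^ 2 * I_sq
    rw [div_eq_mul_one_div _ (1 + I * k), h3]
    simp only [hΦ, boundaryForm]
    rw [hA₁' (omegaSq k), hB₁' (omegaSq k),
      show omegaSq k - 1 = -(1 / (1 + k ^ 2)) by rw [omegaSq]; ring]
    field_simp
    ring
  have hΦd : DifferentiableOn ℂ Φ ({I, -I} : Set ℂ)ᶜ := by
    intro k hk
    have h1 := one_add_sq_ne_zero hk
    have h2 := differentiableAt_omegaSq hk
    exact DifferentiableAt.differentiableWithinAt (by fun_prop (disch := assumption))
  have hΦb : ∀ k : ℂ, 0 ≤ k.im → ‖k + I‖ ≤ 3 * ‖k - I‖ →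
      ‖Φ k‖ ≤ MA₁ + ME + ‖B 1‖ + 6 * MB₁ := by
    intro k hk h3
    simp only [hΦ]
    rw [norm_mul]
    refine (mul_le_of_le_one_left (norm_nonneg _) (norm_exp_I_mul_le_one hk hx.le)).trans ?_
    refine (norm_add_le _ _).trans (add_le_add ((norm_sub_le _ _).trans (add_le_add
      ((norm_add_le _ _).trans (add_le_add ?_ (hME k hk h3))) le_rfl)) ?_)
    · rw [norm_neg]
      exact hMA₁ k hk h3
    · rw [norm_mul]
      exact mul_le_mul (norm_mul_div_one_add_sq_le hk h3) (hMB₁ k hk h3) (norm_nonneg _)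
        (by norm_num)
  have hΦc : Continuous fun k : ℝ => Φ k := by
    refine continuous_iff_continuousAt.2 fun k => ?_
    exact ContinuousAt.comp (f := fun k : ℝ => (k : ℂ)) (hΦd.differentiableAt
      (isOpen_compl_I_neg_I.mem_nhds (ofReal_mem_compl k))).continuousAt (by fun_prop)
  have hint := integrable_div_one_add_sq hΦc fun k => hΦb k (him k) (norm_ofReal_add_I k)
  refine ⟨?_, ?_, ?_⟩
  · have h1 := ((hasImproperIntegral_exp_div hx).const_mul (B 1)).add hint.hasImproperIntegral
    have hfun : (fun k : ℝ => exp (I * k * x) * (boundaryForm A B E k - A 1)) =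
        fun k : ℝ => B 1 * (exp (I * k * x) / (1 + I * k)) + Φ k / (1 + (k : ℂ) ^ 2) :=
      funext fun k => hsplit k (ofReal_mem_compl k)
    rw [hfun]
    convert h1 using 1
    rw [← hγ.contourIntegral_eq_integral hΦd hΦb, ← hγ.contourIntegral_exp_div hx]
    -- The constant must be subtracted on the real line but not on the contour, where `A 1 *
    -- e^{ikx}` is entire and contributes nothing.
    have hz : contourIntegral γ (fun k => A 1 * exp (I * k * x)) = 0 :=
      hγ.contourIntegral_eq_zero_of_differentiableOn (by fun_prop)
    have c0 : ContinuousOn (fun k : ℂ => A 1 * exp (I * k * x)) ({k | 0 < k.im} \ {I}) := by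
      fun_prop
    have c1 : ContinuousOn (fun k : ℂ => B 1 * (exp (I * k * x) / (1 + I * k)))
        ({k | 0 < k.im} \ {I}) :=
      continuousOn_const.mul (ContinuousOn.div (by fun_prop) (by fun_prop)
        fun k hk => one_add_I_mul_ne_zero hk.2)
    have c2 : ContinuousOn (fun k : ℂ => Φ k / (1 + k ^ 2)) ({k | 0 < k.im} \ {I}) :=
      (hΦd.continuousOn.mono upper_sdiff_subset_compl).div (by fun_prop)
        fun k hk => one_add_sq_ne_zero (upper_sdiff_subset_compl hk)
    rw [← zero_add (B 1 * contourIntegral γ _ + _), ← hz]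
    unfold contourIntegral
    rw [← intervalIntegral.integral_const_mul]
    simp only [← mul_assoc]
    have i1 := hγ.intervalIntegrable_comp c1
    simp only [mul_assoc] at i1 ⊢
    rw [← intervalIntegral.integral_add i1 (hγ.intervalIntegrable_comp c2)]
    have i0 := hγ.intervalIntegrable_comp c0
    simp only [mul_assoc] at i0
    rw [← intervalIntegral.integral_add i0 (i1.add (hγ.intervalIntegrable_comp c2))]
    refine intervalIntegral.integral_congr fun s hs => ?_
    rw [uIcc_of_le zero_le_one] at hs
    have hk := hsplit _ (upper_sdiff_subset_compl ⟨hγ.upper s hs, hγ.avoids s hs⟩)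
    simp only [← mul_assoc] at hk ⊢
    linear_combination (deriv γ s) * hk
  · refine continuous_iff_continuousAt.2 fun k => ContinuousAt.mul (by fun_prop) ?_
    refine ContinuousAt.sub ?_ continuousAt_const
    exact ContinuousAt.comp (f := fun k : ℝ => (k : ℂ)) (differentiableAt_boundaryForm hA hB hE
      (ofReal_mem_compl k)).continuousAt (by fun_prop)
  · refine ⟨‖B 1‖ + (MA₁ + ME + ‖B 1‖ + 6 * MB₁), fun k => ?_⟩
    rw [hsplit k (ofReal_mem_compl k)]
    refine (norm_add_le _ _).trans (add_le_add ?_ ?_)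
    · rw [norm_mul, norm_div, norm_exp_I_mul_ofReal_mul]
      refine mul_le_of_le_one_right (norm_nonneg _) (div_le_one_of_le₀ ?_ (norm_nonneg _))
      simpa using abs_re_le_norm (1 + I * (k : ℂ))
    · rw [norm_div]
      refine (div_le_self (norm_nonneg _) ?_).trans (hΦb k (him k) (norm_ofReal_add_I k))
      have := abs_re_le_norm (1 + (k : ℂ) ^ 2)
      have hre : (1 + (k : ℂ) ^ 2).re = 1 + k ^ 2 := by simp [sq]
      rw [hre, abs_of_nonneg (by positivity)] at this
      nlinarith

/-! ### The half-line Fourier transform -/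

theorem integrableOn_div_one_add_sq (M : ℝ) :
    IntegrableOn (fun x : ℝ => M / (1 + x) ^ 2) (Ioi 0) := by
  have hmeas : Measurable fun x : ℝ => M / (1 + x) ^ 2 := by fun_prop
  refine Integrable.mono' ((integrable_inv_one_add_sq.const_mul |M|).integrableOn)
    hmeas.aestronglyMeasurable ?_
  refine (ae_restrict_iff' measurableSet_Ioi).2 (Eventually.of_forall fun x hx => ?_)
  have hx' : 0 < x := hx
  rw [norm_div, Real.norm_eq_abs, Real.norm_of_nonneg (by positivity), div_eq_mul_inv]
  refine mul_le_mul_of_nonneg_left (inv_anti₀ (by positivity) (by nlinarith)) (abs_nonneg _)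

/-- A continuous function on `(0, ∞)` that is `O((1 + x)⁻²)`. -/
structure HasQuadraticDecay (f : ℝ → ℂ) : Prop where
  continuousOn : ContinuousOn f (Ioi 0)
  bound : ∃ M : ℝ, ∀ x : ℝ, 0 < x → ‖f x‖ ≤ M / (1 + x) ^ 2

theorem HasQuadraticDecay.integrableOn {f : ℝ → ℂ} (hf : HasQuadraticDecay f) :
    IntegrableOn f (Ioi 0) := by
  obtain ⟨M, hM⟩ := hf.bound
  refine Integrable.mono' (integrableOn_div_one_add_sq M)
    (hf.continuousOn.aestronglyMeasurable measurableSet_Ioi) ?_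
  exact (ae_restrict_iff' measurableSet_Ioi).2 (Eventually.of_forall fun x hx => hM x hx)

theorem HasQuadraticDecay.add {f g : ℝ → ℂ} (hf : HasQuadraticDecay f)
    (hg : HasQuadraticDecay g) : HasQuadraticDecay fun x => f x + g x := by
  obtain ⟨M, hM⟩ := hf.bound
  obtain ⟨N, hN⟩ := hg.bound
  refine ⟨hf.continuousOn.add hg.continuousOn, M + N, fun x hx => ?_⟩
  rw [add_div]
  exact (norm_add_le _ _).trans (add_le_add (hM x hx) (hN x hx))

theorem HasQuadraticDecay.const_mul {f : ℝ → ℂ} (hf : HasQuadraticDecay f) (c : ℂ) :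
    HasQuadraticDecay fun x => c * f x := by
  obtain ⟨M, hM⟩ := hf.bound
  refine ⟨continuousOn_const.mul hf.continuousOn, ‖c‖ * M, fun x hx => ?_⟩
  rw [norm_mul, mul_div_assoc]
  exact mul_le_mul_of_nonneg_left (hM x hx) (norm_nonneg _)

theorem HasQuadraticDecay.sub {f g : ℝ → ℂ} (hf : HasQuadraticDecay f)
    (hg : HasQuadraticDecay g) : HasQuadraticDecay fun x => f x - g x := by
  simpa [sub_eq_add_neg] using hf.add (hg.const_mul (-1))

theorem HasQuadraticDecay.tendsto_zero {f : ℝ → ℂ} (hf : HasQuadraticDecay f) :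
    Tendsto f atTop (𝓝 0) := by
  obtain ⟨M, hM⟩ := hf.bound
  have h1 : Tendsto (fun x : ℝ => M / (1 + x) ^ 2) atTop (𝓝 0) := by
    refine Tendsto.const_div_atTop ?_ M
    exact (tendsto_pow_atTop two_ne_zero).comp (tendsto_atTop_add_const_left _ 1 tendsto_id)
  refine squeeze_zero_norm' ?_ h1
  filter_upwards [eventually_gt_atTop 0] with x hx using hM x hx

theorem norm_exp_neg_I_mul (k : ℂ) (x : ℝ) : ‖exp (-I * k * x)‖ = Real.exp (k.im * x) := by
  rw [norm_exp]
  simp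

theorem norm_exp_neg_I_mul_le_one {k : ℂ} (hk : k.im ≤ 0) {x : ℝ} (hx : 0 ≤ x) :
    ‖exp (-I * k * x)‖ ≤ 1 := by
  rw [norm_exp_neg_I_mul, Real.exp_le_one_iff]
  exact mul_nonpos_of_nonpos_of_nonneg hk hx

theorem norm_exp_neg_I_mul_mul_le {f : ℝ → ℂ} {k : ℂ} (hk : k.im ≤ 0) {x : ℝ} (hx : 0 ≤ x) :
    ‖exp (-I * k * x) * f x‖ ≤ ‖f x‖ := by
  rw [norm_mul]
  exact mul_le_of_le_one_left (norm_nonneg _) (norm_exp_neg_I_mul_le_one hk hx)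

theorem HasQuadraticDecay.exp_mul {f : ℝ → ℂ} (hf : HasQuadraticDecay f) {k : ℂ}
    (hk : k.im ≤ 0) : HasQuadraticDecay fun x => exp (-I * k * x) * f x := by
  obtain ⟨M, hM⟩ := hf.bound
  refine ⟨ContinuousOn.mul (by fun_prop) hf.continuousOn, M, fun x hx => ?_⟩
  exact (norm_exp_neg_I_mul_mul_le hk hx.le).trans (hM x hx)

theorem halfFourier_sub {f g : ℝ → ℂ} (hf : HasQuadraticDecay f) (hg : HasQuadraticDecay g)
    {k : ℂ} (hk : k.im ≤ 0) :
    halfFourier (fun x => f x - g x) k = halfFourier f k - halfFourier g k := by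
  unfold halfFourier
  rw [← integral_sub (hf.exp_mul hk).integrableOn (hg.exp_mul hk).integrableOn]
  simp only [mul_sub]

theorem HasQuadraticDecay.norm_halfFourier_le {f : ℝ → ℂ} (hf : HasQuadraticDecay f) {k : ℂ}
    (hk : k.im ≤ 0) : ‖halfFourier f k‖ ≤ ∫ x in Ioi (0 : ℝ), ‖f x‖ := by
  refine (norm_integral_le_integral_norm _).trans ?_
  refine setIntegral_mono_on (hf.exp_mul hk).integrableOn.norm hf.integrableOn.norm
    measurableSet_Ioi fun x hx => norm_exp_neg_I_mul_mul_le hk (le_of_lt hx)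

theorem HasQuadraticDecay.continuous_halfFourier {f : ℝ → ℂ} (hf : HasQuadraticDecay f) :
    Continuous fun k : ℝ => halfFourier f k := by
  unfold halfFourier
  refine continuous_of_dominated (bound := fun x => ‖f x‖) ?_ ?_ hf.integrableOn.norm ?_
  · exact fun k => (hf.exp_mul (k := k) (by simp)).integrableOn.aestronglyMeasurable
  · refine fun k => (ae_restrict_iff' measurableSet_Ioi).2 (Eventually.of_forall fun x hx => ?_)
    exact norm_exp_neg_I_mul_mul_le (by simp) (le_of_lt hx)
  · exact Eventually.of_forall fun x => by fun_prop

/-- Differentiating the kernel costs a factor `x`, which the decay `e^{-δx}` available for `Im k <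
-δ` absorbs through `x e^{-δx} ≤ 1/δ`. -/
theorem HasQuadraticDecay.differentiableAt_halfFourier {f : ℝ → ℂ} (hf : HasQuadraticDecay f)
    {k : ℂ} (hk : k.im < 0) : DifferentiableAt ℂ (halfFourier f) k := by
  set δ : ℝ := -k.im / 2 with hδ
  have hδ0 : 0 < δ := by rw [hδ]; linarith
  have hs : {z : ℂ | z.im < -δ} ∈ 𝓝 k := by
    refine (isOpen_lt continuous_im continuous_const).mem_nhds ?_
    simp only [mem_ofPred_eq, hδ]
    linarith
  have key := hasDerivAt_integral_of_dominated_loc_of_deriv_le (μ := volume.restrict (Ioi (0 : ℝ)))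
    (bound := fun x => δ⁻¹ * ‖f x‖)
    (F := fun (z : ℂ) (x : ℝ) => exp (-I * z * x) * f x)
    (F' := fun (z : ℂ) (x : ℝ) => exp (-I * z * x) * (-I * x) * f x) hs ?_ ?_ ?_ ?_ ?_ ?_
  · exact key.2.differentiableAt
  · filter_upwards [hs] with z hz
    have hz' : z.im < -δ := hz
    exact (hf.exp_mul (k := z) (by linarith)).integrableOn.aestronglyMeasurable
  · exact (hf.exp_mul hk.le).integrableOn
  · exact (ContinuousOn.mul (by fun_prop) hf.continuousOn).aestronglyMeasurable measurableSet_Ioi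
  · refine (ae_restrict_iff' measurableSet_Ioi).2 (Eventually.of_forall fun x hx z hz => ?_)
    have hx' : 0 < x := hx
    have hz' : z.im < -δ := hz
    rw [norm_mul, norm_mul, norm_exp_neg_I_mul]
    refine mul_le_mul_of_nonneg_right ?_ (norm_nonneg _)
    have h1 : ‖-I * (x : ℂ)‖ = x := by simp [abs_of_pos hx']
    rw [h1]
    have h2 : Real.exp (z.im * x) ≤ Real.exp (-(δ * x)) := Real.exp_le_exp.2 (by nlinarith)
    have h3 : δ * x ≤ Real.exp (δ * x) := by linarith [Real.add_one_le_exp (δ * x)]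
    have h4 : Real.exp (-(δ * x)) * x ≤ δ⁻¹ := by
      rw [Real.exp_neg, inv_mul_le_iff₀ (Real.exp_pos _), ← div_eq_mul_inv, le_div_iff₀ hδ0]
      linarith
    exact (mul_le_mul_of_nonneg_right h2 hx'.le).trans h4
  · exact hf.integrableOn.norm.const_mul _
  · refine Eventually.of_forall fun x z _ => ?_
    have hd : HasDerivAt (fun z : ℂ => -I * z * x) (-I * x) z := by
      simpa using ((hasDerivAt_id z).const_mul (-I)).mul_const (x : ℂ)
    exact hd.cexp.mul_const _

/-- The half-line transform of a derivative. -/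
theorem halfFourier_deriv {f f' : ℝ → ℂ} (hf : HasQuadraticDecay f) (hf' : HasQuadraticDecay f')
    (hc : ContinuousWithinAt f (Ici 0) 0) (hd : ∀ x, 0 < x → HasDerivAt f (f' x) x) {k : ℂ}
    (hk : k.im ≤ 0) : halfFourier f' k = -f 0 + I * k * halfFourier f k := by
  have hexp : ∀ x : ℝ, HasDerivAt (fun x : ℝ => exp (-I * k * x))
      (exp (-I * k * x) * (-I * k)) x := by
    intro x
    have hd : HasDerivAt (fun x : ℝ => -I * k * (x : ℂ)) (-I * k) x := by
      simpa using (Complex.ofRealCLM.hasDerivAt (x := x)).const_mul (-I * k)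
    exact hd.cexp
  have i1 := (hf'.exp_mul hk).integrableOn
  have i2 := ((hf.exp_mul hk).integrableOn).const_mul (-I * k)
  have h := integral_Ioi_of_hasDerivAt_of_tendsto (f := fun x : ℝ => exp (-I * k * x) * f x)
    (f' := fun x => exp (-I * k * x) * f' x + (-I * k) * (exp (-I * k * x) * f x))
    (a := 0) (m := 0) (ContinuousWithinAt.mul (by fun_prop) hc)
    (fun x hx => ((hexp x).mul (hd x hx)).congr_deriv (by ring)) (i1.add i2)
    (hf.exp_mul hk).tendsto_zero
  rw [integral_add i1 i2, integral_const_mul] at h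
  simp only [ofReal_zero, mul_zero, exp_zero, one_mul, zero_sub] at h
  unfold halfFourier
  linear_combination h

theorem hasQuadraticDecay_mul_exp {g : ℝ → ℂ} (hg : Continuous g) {C : ℝ}
    (hC : ∀ x : ℝ, 0 < x → ‖g x‖ ≤ C * (1 + x)) :
    HasQuadraticDecay fun x : ℝ => g x * (Real.exp (-x) : ℂ) := by
  refine ⟨by fun_prop, 27 * C, fun x hx => ?_⟩
  -- The 27 is `3³`: `1 + x ≤ 3(1 + x/3)` and `(1 + x/3)³ ≤ e^x`.
  have h1 : (1 + x) ^ 3 ≤ 27 * Real.exp x := by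
    have h2 : x / 3 + 1 ≤ Real.exp (x / 3) := Real.add_one_le_exp _
    have h3 : (x / 3 + 1) ^ 3 ≤ Real.exp (x / 3) ^ 3 := pow_le_pow_left₀ (by positivity) h2 3
    rw [← Real.exp_nat_mul, show ((3 : ℕ) : ℝ) * (x / 3) = x by push_cast; ring] at h3
    nlinarith [sq_nonneg x, pow_pos hx 3]
  have hC0 : 0 ≤ C := by
    have := (norm_nonneg _).trans (hC x hx)
    by_contra hcon
    push Not at hcon
    nlinarith
  rw [norm_mul, norm_real, Real.norm_of_nonneg (Real.exp_pos _).le, le_div_iff₀ (by positivity),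
    Real.exp_neg]
  have h4 := hC x hx
  have h5 := Real.exp_pos x
  calc ‖g x‖ * (Real.exp x)⁻¹ * (1 + x) ^ 2 ≤ C * (1 + x) * (Real.exp x)⁻¹ * (1 + x) ^ 2 := by
        gcongr
    _ = C * (1 + x) ^ 3 * (Real.exp x)⁻¹ := by ring
    _ ≤ C * (27 * Real.exp x) * (Real.exp x)⁻¹ := by gcongr
    _ = 27 * C := by field_simp

/-- Fourier inversion on the half-line for functions vanishing at the origin. -/
theorem integral_exp_mul_halfFourier_of_zero {f f₁ f₂ : ℝ → ℂ} (hf : HasQuadraticDecay f)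
    (hf₁ : HasQuadraticDecay f₁) (hf₂ : HasQuadraticDecay f₂)
    (hc : ContinuousWithinAt f (Ici 0) 0) (hc₁ : ContinuousWithinAt f₁ (Ici 0) 0)
    (hd : ∀ x, 0 < x → HasDerivAt f (f₁ x) x) (hd₁ : ∀ x, 0 < x → HasDerivAt f₁ (f₂ x) x)
    (h0 : f 0 = 0) {x : ℝ} (hx : 0 < x) :
    Integrable (fun k : ℝ => exp (I * k * x) * halfFourier f k) ∧
      ∫ k : ℝ, exp (I * k * x) * halfFourier f k = 2 * Real.pi * f x := by
  -- Two integrations by parts, with `f 0 = 0` killing the term of order `1/k`; this makes the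
  -- transform integrable.
  have hrep : ∀ k : ℝ, halfFourier f k =
      (halfFourier f k - halfFourier f₂ k - f₁ 0) / (1 + (k : ℂ) ^ 2) := by
    intro k
    rw [halfFourier_deriv hf₁ hf₂ hc₁ hd₁ (k := k) (by simp),
      halfFourier_deriv hf hf₁ hc hd (k := k) (by simp), h0,
      eq_div_iff (one_add_ofReal_sq_ne_zero k)]
    linear_combination ((k : ℂ) ^ 2 * halfFourier f k) * I_sq
  have hint : Integrable fun k : ℝ => halfFourier f k := by
    have := integrable_div_one_add_sq
      (Φ := fun k : ℝ => halfFourier f k - halfFourier f₂ k - f₁ 0)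
      ((hf.continuous_halfFourier.sub hf₂.continuous_halfFourier).sub continuous_const)
      (M := (∫ x in Ioi (0 : ℝ), ‖f x‖) + (∫ x in Ioi (0 : ℝ), ‖f₂ x‖) + ‖f₁ 0‖) (fun k =>
        (norm_sub_le _ _).trans (add_le_add ((norm_sub_le _ _).trans (add_le_add
          (hf.norm_halfFourier_le (by simp)) (hf₂.norm_halfFourier_le (by simp)))) le_rfl))
    refine this.congr (Eventually.of_forall fun k => (hrep k).symm)
  refine ⟨?_, ?_⟩
  · refine hint.norm.mono' ((Continuous.mul (by fun_prop)
      hf.continuous_halfFourier).aestronglyMeasurable) (Eventually.of_forall fun k => ?_)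
    rw [norm_mul, norm_exp_I_mul_ofReal_mul, one_mul]
  -- Extension by zero reduces to inversion on the whole line, with `k = 2πw`; only continuity at
  -- the given `x > 0` is needed.
  set F : ℝ → ℂ := (Ioi (0 : ℝ)).indicator f with hF
  have hFi : Integrable F := hf.integrableOn.integrable_indicator measurableSet_Ioi
  have hFF : ∀ w : ℝ, FourierTransform.fourier F w = halfFourier f ((2 * Real.pi * w : ℝ) : ℂ) := by
    intro w
    rw [Real.fourier_real_eq_integral_exp_smul, halfFourier, ← integral_indicator measurableSet_Ioi]
    refine integral_congr_ae (Eventually.of_forall fun v => ?_)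
    simp only [hF, indicator_apply]
    split_ifs
    · rw [smul_eq_mul]
      congr 2
      push_cast
      ring
    · simp
  have hpi : (2 * Real.pi : ℝ) ≠ 0 := Real.two_pi_pos.ne'
  have hFFi : Integrable (FourierTransform.fourier F) := by
    rw [show FourierTransform.fourier F = fun w => halfFourier f ((2 * Real.pi * w : ℝ) : ℂ) from
      funext hFF]
    exact (integrable_comp_mul_left_iff (fun k : ℝ => halfFourier f k) hpi).2 hint
  have hcont : ContinuousAt F x := by
    refine ((hf.continuousOn.continuousAt (Ioi_mem_nhds hx))).congr ?_
    filter_upwards [Ioi_mem_nhds hx] with y hy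
    simp [hF, indicator_of_mem hy]
  have hinv := hFi.fourierInv_fourier_eq hFFi hcont
  rw [Real.fourierInv_eq'] at hinv
  have hs := Measure.integral_comp_mul_left
    (fun k : ℝ => exp (I * k * x) * halfFourier f k) (2 * Real.pi)
  have hFx : F x = f x := by simp [hF, hx]
  rw [hFx] at hinv
  have h3 : ∫ v : ℝ, exp (((2 * Real.pi * inner ℝ v x : ℝ) : ℂ) * I) • FourierTransform.fourier F v
      = ∫ v : ℝ, exp (I * ((2 * Real.pi * v : ℝ) : ℂ) * x) *
        halfFourier f ((2 * Real.pi * v : ℝ) : ℂ) := by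
    refine integral_congr_ae (Eventually.of_forall fun v => ?_)
    simp only [smul_eq_mul, hFF]
    congr 2
    simp
    ring
  rw [h3, hs, abs_of_pos (inv_pos.2 Real.two_pi_pos), real_smul] at hinv
  have hpi' : ((2 * Real.pi : ℝ) : ℂ) ≠ 0 := by exact_mod_cast hpi
  rw [← hinv, ofReal_inv, show (2 * Real.pi : ℂ) = ((2 * Real.pi : ℝ) : ℂ) by push_cast; rfl,
    mul_inv_cancel_left₀ hpi']

theorem hasDerivAt_exp_neg (x : ℝ) :
    HasDerivAt (fun x : ℝ => (Real.exp (-x) : ℂ)) (-(Real.exp (-x) : ℂ)) x := by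
  have := ((hasDerivAt_id x).neg.exp).ofReal_comp
  simpa using this

theorem hasDerivAt_mul_exp_neg {g : ℝ → ℂ} {g' : ℂ} {x : ℝ} (hg : HasDerivAt g g' x) :
    HasDerivAt (fun x : ℝ => g x * (Real.exp (-x) : ℂ)) ((g' - g x) * (Real.exp (-x) : ℂ)) x :=
  (hg.mul (hasDerivAt_exp_neg x)).congr_deriv (by ring)

theorem halfFourier_exp_neg (k : ℝ) :
    halfFourier (fun x => (Real.exp (-x) : ℂ)) k = 1 / (1 + I * k) := by
  have h1 : (-(1 + I * (k : ℂ))).re < 0 := by simp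
  have e1 := integral_exp_mul_complex_Ioi h1 0
  simp only [ofReal_zero, mul_zero, exp_zero] at e1
  rw [neg_div_neg_eq] at e1
  rw [← e1, halfFourier]
  refine integral_congr_ae (Eventually.of_forall fun x => ?_)
  simp only [ofReal_exp]
  rw [← exp_add]
  congr 1
  push_cast
  ring

theorem hasQuadraticDecay_exp_neg : HasQuadraticDecay fun x => (Real.exp (-x) : ℂ) := by
  have := hasQuadraticDecay_mul_exp (g := fun _ => 1) (by fun_prop) (C := 1)
    (fun x hx => by rw [norm_one]; linarith)
  simpa only [one_mul] using this

/-- The function `x e^{-x}` vanishes at 0 and has transform `1/(1 + ik)²`, so inversion evaluates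
the integral without residues. -/
theorem integral_exp_div_sq {x : ℝ} (hx : 0 < x) :
    ∫ k : ℝ, exp (I * k * x) / (1 + I * k) ^ 2 =
      2 * (Real.pi : ℂ) * ((x : ℂ) * (Real.exp (-x) : ℂ)) := by
  have d0 : HasQuadraticDecay fun x : ℝ => (x : ℂ) * (Real.exp (-x) : ℂ) :=
    hasQuadraticDecay_mul_exp (g := fun x : ℝ => (x : ℂ)) (by fun_prop) (C := 1)
      (fun x hx => by rw [norm_real, Real.norm_of_nonneg hx.le]; linarith)
  have d1 : HasQuadraticDecay fun x : ℝ => (1 - (x : ℂ)) * (Real.exp (-x) : ℂ) :=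
    hasQuadraticDecay_mul_exp (g := fun x : ℝ => 1 - (x : ℂ)) (by fun_prop) (C := 1)
      (fun x hx => (norm_sub_le _ _).trans (by
        rw [norm_real, norm_one, Real.norm_of_nonneg hx.le]; linarith))
  have d2 : HasQuadraticDecay fun x : ℝ => (-1 - (1 - (x : ℂ))) * (Real.exp (-x) : ℂ) :=
    hasQuadraticDecay_mul_exp (g := fun x : ℝ => -1 - (1 - (x : ℂ))) (by fun_prop) (C := 2)
      (fun x hx => by
        rw [show (-1 - (1 - (x : ℂ))) = x - 2 by ring]
        refine (norm_sub_le _ _).trans ?_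
        rw [norm_real, Real.norm_of_nonneg hx.le]
        norm_num
        linarith)
  have h1 : ∀ x : ℝ, HasDerivAt (fun x : ℝ => (x : ℂ) * (Real.exp (-x) : ℂ))
      ((1 - (x : ℂ)) * (Real.exp (-x) : ℂ)) x := fun x =>
    hasDerivAt_mul_exp_neg (Complex.ofRealCLM.hasDerivAt (x := x))
  have h2 : ∀ x : ℝ, HasDerivAt (fun x : ℝ => (1 - (x : ℂ)) * (Real.exp (-x) : ℂ))
      ((-1 - (1 - (x : ℂ))) * (Real.exp (-x) : ℂ)) x := fun x =>
    hasDerivAt_mul_exp_neg (g := fun x : ℝ => 1 - (x : ℂ))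
      ((Complex.ofRealCLM.hasDerivAt (x := x)).const_sub 1)
  have key := (integral_exp_mul_halfFourier_of_zero d0 d1 d2 (by fun_prop) (by fun_prop)
    (fun x _ => h1 x) (fun x _ => h2 x) (by simp) hx).2
  rw [← key]
  refine integral_congr_ae (Eventually.of_forall fun k => ?_)
  have hk : ((k : ℂ)).im ≤ 0 := by simp
  have e1 := halfFourier_deriv d0 d1 (by fun_prop) (fun x _ => h1 x) hk
  have e2 : halfFourier (fun x : ℝ => (1 - (x : ℂ)) * (Real.exp (-x) : ℂ)) k =
      halfFourier (fun x => (Real.exp (-x) : ℂ)) k -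
        halfFourier (fun x : ℝ => (x : ℂ) * (Real.exp (-x) : ℂ)) k := by
    rw [← halfFourier_sub hasQuadraticDecay_exp_neg d0 hk]
    simp only [sub_mul, one_mul]
  rw [e2, halfFourier_exp_neg] at e1
  have hne := one_add_I_mul_ofReal_ne_zero k
  have e3 : halfFourier (fun x : ℝ => (x : ℂ) * (Real.exp (-x) : ℂ)) k = 1 / (1 + I * k) ^ 2 := by
    have e4 : (1 + I * (k : ℂ)) * halfFourier (fun x : ℝ => (x : ℂ) * (Real.exp (-x) : ℂ)) k =
        1 / (1 + I * k) := by
      simp only [ofReal_zero, zero_mul, neg_zero] at e1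
      linear_combination -e1
    have e5 := one_div_mul_cancel hne
    rw [eq_div_iff (pow_ne_zero 2 hne)]
    linear_combination (1 + I * (k : ℂ)) * e4 + e5
  simp only
  rw [e3, mul_one_div]

/-- Fourier inversion on the half-line. -/
theorem hasImproperIntegral_exp_mul_halfFourier {f f₁ f₂ : ℝ → ℂ} (hf : HasQuadraticDecay f)
    (hf₁ : HasQuadraticDecay f₁) (hf₂ : HasQuadraticDecay f₂)
    (hc : ContinuousWithinAt f (Ici 0) 0) (hc₁ : ContinuousWithinAt f₁ (Ici 0) 0)
    (hd : ∀ x, 0 < x → HasDerivAt f (f₁ x) x) (hd₁ : ∀ x, 0 < x → HasDerivAt f₁ (f₂ x) x)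
    {x : ℝ} (hx : 0 < x) :
    HasImproperIntegral (fun k : ℝ => exp (I * k * x) * halfFourier f k) (2 * Real.pi * f x) := by
  set e : ℝ → ℂ := fun x => (Real.exp (-x) : ℂ) with he
  have hde := hasQuadraticDecay_exp_neg
  have hce : ContinuousWithinAt e (Ici 0) 0 := by fun_prop
  -- Subtracting `f(0)e^{-x}` reduces to vanishing at the origin. Its transform `f(0)/(1 + ik)`
  -- carries all the conditional convergence.
  have hg := integral_exp_mul_halfFourier_of_zero (f := fun x => f x - f 0 * e x)
    (f₁ := fun x => f₁ x + f 0 * e x) (f₂ := fun x => f₂ x - f 0 * e x)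
    (hf.sub (hde.const_mul _)) (hf₁.add (hde.const_mul _)) (hf₂.sub (hde.const_mul _))
    (hc.sub (continuousWithinAt_const.mul hce)) (hc₁.add (continuousWithinAt_const.mul hce))
    (fun x hx => ((hd x hx).sub ((hasDerivAt_exp_neg x).const_mul (f 0))).congr_deriv (by
      simp only [he]; ring))
    (fun x hx => ((hd₁ x hx).add ((hasDerivAt_exp_neg x).const_mul (f 0))).congr_deriv (by
      simp only [he]; ring)) (by simp [he]) hx
  have h1 := hg.1.hasImproperIntegral
  rw [hg.2] at h1
  have h2 := hasImproperIntegral_exp_div hx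
  rw [integral_exp_div_sq hx] at h2
  have h3 := h1.add (h2.const_mul (f 0))
  have hxc : (x : ℂ) ≠ 0 := by exact_mod_cast hx.ne'
  convert h3 using 1
  · ext k
    have hk : ((k : ℂ)).im ≤ 0 := by simp
    have : halfFourier (fun x => f x - f 0 * e x) k = halfFourier f k - f 0 * halfFourier e k := by
      rw [halfFourier_sub hf (hde.const_mul _) hk]
      simp only [halfFourier, ← integral_const_mul, mul_left_comm _ (f 0)]
      rfl
    rw [this, halfFourier_exp_neg]
    ring
  · simp only [he]
    field_simp
    ring

/-! ### Smooth functions on the closed quarter-plane -/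

/-- The closed quarter-plane. -/
def quadrant : Set (ℝ × ℝ) := Ici 0 ×ˢ Ici 0

/-- The one-sided `x`-derivative on the closed quarter-plane. -/
def dX (u : ℝ × ℝ → ℂ) (p : ℝ × ℝ) : ℂ := fderivWithin ℝ u quadrant p (1, 0)

/-- The one-sided `t`-derivative on the closed quarter-plane. -/
def dT (u : ℝ × ℝ → ℂ) (p : ℝ × ℝ) : ℂ := fderivWithin ℝ u quadrant p (0, 1)

theorem uniqueDiffOn_quadrant : UniqueDiffOn ℝ quadrant :=
  (uniqueDiffOn_Ici 0).prod (uniqueDiffOn_Ici 0)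

theorem quadrant_mem_nhds {x t : ℝ} (hx : 0 < x) (ht : 0 < t) : quadrant ∈ 𝓝 (x, t) :=
  prod_mem_nhds (Ici_mem_nhds hx) (Ici_mem_nhds ht)

section Quadrant

variable {u : ℝ × ℝ → ℂ}

theorem contDiffOn_dX (hu : ContDiffOn ℝ ∞ u quadrant) : ContDiffOn ℝ ∞ (dX u) quadrant :=
  (hu.fderivWithin uniqueDiffOn_quadrant (m := ∞) (by simp)).clm_apply contDiffOn_const

theorem contDiffOn_dT (hu : ContDiffOn ℝ ∞ u quadrant) : ContDiffOn ℝ ∞ (dT u) quadrant :=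
  (hu.fderivWithin uniqueDiffOn_quadrant (m := ∞) (by simp)).clm_apply contDiffOn_const

theorem contDiffOn_iterate_dX (hu : ContDiffOn ℝ ∞ u quadrant) (a : ℕ) :
    ContDiffOn ℝ ∞ (dX^[a] u) quadrant := by
  induction a with
  | zero => exact hu
  | succ a ih =>
    rw [Function.iterate_succ_apply']
    exact contDiffOn_dX ih

theorem contDiffOn_iterate_dT (hu : ContDiffOn ℝ ∞ u quadrant) (b : ℕ) :
    ContDiffOn ℝ ∞ (dT^[b] u) quadrant := by
  induction b with
  | zero => exact hu
  | succ b ih =>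
    rw [Function.iterate_succ_apply']
    exact contDiffOn_dT ih

theorem hasDerivAt_dX (hu : ContDiffOn ℝ ∞ u quadrant) {x t : ℝ} (hx : 0 < x) (ht : 0 ≤ t) :
    HasDerivAt (fun y => u (y, t)) (dX u (x, t)) x := by
  have h1 : HasFDerivWithinAt u (fderivWithin ℝ u quadrant (x, t)) quadrant (x, t) :=
    ((hu.differentiableOn (by simp)) (x, t) ⟨hx.le, ht⟩).hasFDerivWithinAt
  have h2 : HasDerivAt (fun y : ℝ => (y, t)) ((1 : ℝ), (0 : ℝ)) x :=
    (hasDerivAt_id x).prodMk (hasDerivAt_const x t)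
  refine h1.comp_hasDerivAt (f := fun y : ℝ => (y, t)) x h2 ?_
  filter_upwards [Ioi_mem_nhds hx] with y hy
  exact ⟨mem_Ici.2 (le_of_lt hy), ht⟩

theorem hasDerivAt_dT (hu : ContDiffOn ℝ ∞ u quadrant) {x t : ℝ} (hx : 0 ≤ x) (ht : 0 < t) :
    HasDerivAt (fun s => u (x, s)) (dT u (x, t)) t := by
  have h1 : HasFDerivWithinAt u (fderivWithin ℝ u quadrant (x, t)) quadrant (x, t) :=
    ((hu.differentiableOn (by simp)) (x, t) ⟨hx, ht.le⟩).hasFDerivWithinAt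
  have h2 : HasDerivAt (fun s : ℝ => (x, s)) ((0 : ℝ), (1 : ℝ)) t :=
    (hasDerivAt_const t x).prodMk (hasDerivAt_id t)
  refine h1.comp_hasDerivAt (f := fun s : ℝ => (x, s)) t h2 ?_
  filter_upwards [Ioi_mem_nhds ht] with s hs
  exact ⟨hx, mem_Ici.2 (le_of_lt hs)⟩

/-- At interior points the one-sided derivatives are ordinary ones, and the second derivative is
symmetric. -/
theorem dX_dT_comm (hu : ContDiffOn ℝ ∞ u quadrant) {x t : ℝ} (hx : 0 < x) (ht : 0 < t) :
    dX (dT u) (x, t) = dT (dX u) (x, t) := by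
  have hq := quadrant_mem_nhds hx ht
  have hsm : ContDiffAt ℝ ∞ u (x, t) := hu.contDiffAt hq
  have hev : ∀ v : ℝ × ℝ, (fun p => fderivWithin ℝ u quadrant p v) =ᶠ[𝓝 (x, t)]
      fun p => fderiv ℝ u p v := by
    intro v
    filter_upwards [eventually_mem_nhds_iff.2 hq] with p hp
    rw [fderivWithin_of_mem_nhds hp]
  have hdiff : DifferentiableAt ℝ (fderiv ℝ u) (x, t) :=
    (hsm.fderiv_right (m := 1) (by norm_cast)).differentiableAt one_ne_zero
  have hD : ∀ v w : ℝ × ℝ, fderivWithin ℝ (fun p => fderivWithin ℝ u quadrant p v) quadrant (x, t) w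
      = fderiv ℝ (fderiv ℝ u) (x, t) w v := by
    intro v w
    rw [fderivWithin_of_mem_nhds hq, (hev v).fderiv_eq, fderiv_clm_apply hdiff (by fun_prop)]
    simp
  change fderivWithin ℝ (fun p => fderivWithin ℝ u quadrant p (0, 1)) quadrant (x, t) (1, 0) =
    fderivWithin ℝ (fun p => fderivWithin ℝ u quadrant p (1, 0)) quadrant (x, t) (0, 1)
  rw [hD, hD]
  exact hsm.isSymmSndFDerivAt (by
    rw [minSmoothness_of_isRCLikeNormedField]
    exact WithTop.coe_le_coe.2 (le_top : (2 : ℕ∞) ≤ ⊤)) _ _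

theorem iteratedDeriv_eq_iterate_dX (hu : ContDiffOn ℝ ∞ u quadrant) (a : ℕ) {x t : ℝ}
    (hx : 0 < x) (ht : 0 ≤ t) : iteratedDeriv a (fun y => u (y, t)) x = dX^[a] u (x, t) := by
  induction a generalizing x with
  | zero => simp
  | succ a ih =>
    rw [iteratedDeriv_succ, Function.iterate_succ_apply']
    have : iteratedDeriv a (fun y => u (y, t)) =ᶠ[𝓝 x] fun y => dX^[a] u (y, t) := by
      filter_upwards [Ioi_mem_nhds hx] with y hy using ih hy
    rw [this.deriv_eq]
    exact (hasDerivAt_dX (contDiffOn_iterate_dX hu a) hx ht).deriv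

theorem iteratedDeriv_eq_iterate_dT (hu : ContDiffOn ℝ ∞ u quadrant) (b : ℕ) {x t : ℝ}
    (hx : 0 ≤ x) (ht : 0 < t) : iteratedDeriv b (fun s => u (x, s)) t = dT^[b] u (x, t) := by
  induction b generalizing t with
  | zero => simp
  | succ b ih =>
    rw [iteratedDeriv_succ, Function.iterate_succ_apply']
    have : iteratedDeriv b (fun s => u (x, s)) =ᶠ[𝓝 t] fun s => dT^[b] u (x, s) := by
      filter_upwards [Ioi_mem_nhds ht] with s hs using ih hs
    rw [this.deriv_eq]
    exact (hasDerivAt_dT (contDiffOn_iterate_dT hu b) hx ht).deriv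

/-- Connects the two-sided derivatives of the hypotheses with one-sided derivatives that are
continuous up to the boundary. -/
theorem partialDeriv_eq (hu : ContDiffOn ℝ ∞ u quadrant) (a b : ℕ) {x t : ℝ} (hx : 0 < x)
    (ht : 0 < t) : partialDeriv a b (fun x t => u (x, t)) x t = dT^[b] (dX^[a] u) (x, t) := by
  unfold partialDeriv
  have : (fun s => iteratedDeriv a (fun y => u (y, s)) x) =ᶠ[𝓝 t] fun s => dX^[a] u (x, s) := by
    filter_upwards [Ioi_mem_nhds ht] with s hs
    exact iteratedDeriv_eq_iterate_dX hu a hx (le_of_lt hs)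
  rw [this.iteratedDeriv_eq]
  exact iteratedDeriv_eq_iterate_dT (contDiffOn_iterate_dX hu a) b hx.le ht

theorem continuousOn_slice_fst (hu : ContinuousOn u quadrant) {t : ℝ} (ht : 0 ≤ t) :
    ContinuousOn (fun x => u (x, t)) (Ici 0) :=
  hu.comp (f := fun x : ℝ => (x, t)) (by fun_prop) fun _ hx => ⟨hx, ht⟩

theorem continuousOn_slice_snd (hu : ContinuousOn u quadrant) {x : ℝ} (hx : 0 ≤ x) :
    ContinuousOn (fun t => u (x, t)) (Ici 0) :=
  hu.comp (f := fun t : ℝ => (x, t)) (by fun_prop) fun _ ht => ⟨hx, ht⟩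

/-- The decay hypothesis concerns `t > 0`; continuity up to `t = 0` extends the bound to the initial
time. The horizon `max T 1` keeps it usable for every real `T`. -/
theorem exists_bound_of_decaysAtInfinity (hu : ContDiffOn ℝ ∞ u quadrant)
    (hdec : DecaysAtInfinity fun x t => u (x, t)) {a b : ℕ} (ha : a ≤ 3) (hb : b ≤ 1) (T : ℝ) :
    ∃ M : ℝ, ∀ x t : ℝ, 0 < x → 0 ≤ t → t ≤ T →
      ‖dT^[b] (dX^[a] u) (x, t)‖ ≤ M / (1 + x) ^ 2 := by
  obtain ⟨M, hM⟩ := hdec a b ha hb (max T 1) (by positivity)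
  refine ⟨M, fun x t hx ht htT => ?_⟩
  have hpos : ∀ s, 0 < s → s ≤ max T 1 → ‖dT^[b] (dX^[a] u) (x, s)‖ ≤ M / (1 + x) ^ 2 := by
    intro s hs hsT
    rw [← partialDeriv_eq hu a b hx hs]
    exact hM x s hx hs hsT
  rcases ht.eq_or_lt with rfl | ht0
  · have hc := continuousOn_slice_snd
      (contDiffOn_iterate_dT (contDiffOn_iterate_dX hu a) b).continuousOn hx.le
    have h1 : Tendsto (fun s => ‖dT^[b] (dX^[a] u) (x, s)‖) (𝓝[>] 0)
        (𝓝 ‖dT^[b] (dX^[a] u) (x, 0)‖) :=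
      ((hc 0 (mem_Ici.2 le_rfl)).mono Ioi_subset_Ici_self).norm
    refine le_of_tendsto h1 ?_
    have hlt : ∀ᶠ s : ℝ in 𝓝[>] 0, s < 1 := mem_nhdsWithin_of_mem_nhds (Iio_mem_nhds one_pos)
    filter_upwards [self_mem_nhdsWithin, hlt] with s hs hs1
    exact hpos s hs (hs1.le.trans (le_max_right _ _))
  · exact hpos t ht0 (htT.trans (le_max_left _ _))

theorem hasQuadraticDecay_slice (hu : ContDiffOn ℝ ∞ u quadrant)
    (hdec : DecaysAtInfinity fun x t => u (x, t)) {a b : ℕ} (ha : a ≤ 3) (hb : b ≤ 1) {t : ℝ}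
    (ht : 0 ≤ t) : HasQuadraticDecay fun x => dT^[b] (dX^[a] u) (x, t) := by
  obtain ⟨M, hM⟩ := exists_bound_of_decaysAtInfinity hu hdec ha hb t
  refine ⟨?_, M, fun x hx => hM x t hx ht le_rfl⟩
  exact (continuousOn_slice_fst (contDiffOn_iterate_dT (contDiffOn_iterate_dX hu a) b).continuousOn
    ht).mono Ioi_subset_Ici_self

/-- Fourier inversion for the slices of a decaying smooth function. -/
theorem hasImproperIntegral_slice (hu : ContDiffOn ℝ ∞ u quadrant)
    (hdec : DecaysAtInfinity fun x t => u (x, t)) {x t : ℝ} (hx : 0 < x) (ht : 0 ≤ t) :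
    HasImproperIntegral (fun k : ℝ => exp (I * k * x) * halfFourier (fun y => u (y, t)) k)
      (2 * Real.pi * u (x, t)) := by
  have hX := contDiffOn_dX hu
  have h0 : (0 : ℝ) ∈ Ici (0 : ℝ) := mem_Ici.2 le_rfl
  exact hasImproperIntegral_exp_mul_halfFourier (f := fun y => u (y, t))
    (f₁ := fun y => dX u (y, t)) (f₂ := fun y => dX (dX u) (y, t))
    (hasQuadraticDecay_slice hu hdec (a := 0) (b := 0) (by norm_num) (by norm_num) ht)
    (hasQuadraticDecay_slice hu hdec (a := 1) (b := 0) (by norm_num) (by norm_num) ht)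
    (hasQuadraticDecay_slice hu hdec (a := 2) (b := 0) (by norm_num) (by norm_num) ht)
    (continuousOn_slice_fst hu.continuousOn ht 0 h0)
    (continuousOn_slice_fst hX.continuousOn ht 0 h0)
    (fun y hy => hasDerivAt_dX hu hy ht) (fun y hy => hasDerivAt_dX hX hy ht) hx

theorem continuousOn_halfFourier_slice (hu : ContDiffOn ℝ ∞ u quadrant)
    (hdec : DecaysAtInfinity fun x t => u (x, t)) {k : ℂ} (hk : k.im ≤ 0) (T : ℝ) :
    ContinuousOn (fun t => halfFourier (fun x => u (x, t)) k) (Icc 0 T) := by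
  obtain ⟨M, hM⟩ := exists_bound_of_decaysAtInfinity hu hdec (a := 0) (b := 0) (by norm_num)
    (by norm_num) T
  unfold halfFourier
  refine continuousOn_of_dominated (bound := fun x => M / (1 + x) ^ 2) ?_ ?_
    (integrableOn_div_one_add_sq M) ?_
  · intro t ht
    exact ((hasQuadraticDecay_slice hu hdec (a := 0) (b := 0) (by norm_num) (by norm_num)
      ht.1).exp_mul hk).integrableOn.aestronglyMeasurable
  · intro t ht
    refine (ae_restrict_iff' measurableSet_Ioi).2 (Eventually.of_forall fun x hx => ?_)
    exact (norm_exp_neg_I_mul_mul_le (f := fun x => u (x, t)) hk (le_of_lt hx)).trans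
      (hM x t hx ht.1 ht.2)
  · refine (ae_restrict_iff' measurableSet_Ioi).2 (Eventually.of_forall fun x hx => ?_)
    exact continuousOn_const.mul
      ((continuousOn_slice_snd hu.continuousOn (le_of_lt hx)).mono Icc_subset_Ici_self)

theorem hasDerivAt_halfFourier_slice (hu : ContDiffOn ℝ ∞ u quadrant)
    (hdec : DecaysAtInfinity fun x t => u (x, t)) {k : ℂ} (hk : k.im ≤ 0) {t : ℝ} (ht : 0 < t) :
    HasDerivAt (fun t => halfFourier (fun x => u (x, t)) k)
      (halfFourier (fun x => dT u (x, t)) k) t := by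
  obtain ⟨M, hM⟩ := exists_bound_of_decaysAtInfinity hu hdec (a := 0) (b := 1) (by norm_num)
    (by norm_num) (t + 1)
  unfold halfFourier
  refine (hasDerivAt_integral_of_dominated_loc_of_deriv_le (s := Ioo 0 (t + 1))
    (bound := fun x => M / (1 + x) ^ 2)
    (F := fun (t : ℝ) (x : ℝ) => exp (-I * k * x) * u (x, t))
    (F' := fun (t : ℝ) (x : ℝ) => exp (-I * k * x) * dT u (x, t))
    (Ioo_mem_nhds ht (lt_add_one t)) ?_ ?_ ?_ ?_ (integrableOn_div_one_add_sq M) ?_).2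
  · filter_upwards [Ioi_mem_nhds ht] with s hs
    exact ((hasQuadraticDecay_slice hu hdec (a := 0) (b := 0) (by norm_num) (by norm_num)
      (le_of_lt hs)).exp_mul hk).integrableOn.aestronglyMeasurable
  · exact ((hasQuadraticDecay_slice hu hdec (a := 0) (b := 0) (by norm_num) (by norm_num)
      ht.le).exp_mul hk).integrableOn
  · exact ((hasQuadraticDecay_slice hu hdec (a := 0) (b := 1) (by norm_num) (by norm_num)
      ht.le).exp_mul hk).integrableOn.aestronglyMeasurable
  · refine (ae_restrict_iff' measurableSet_Ioi).2 (Eventually.of_forall fun x hx s hs => ?_)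
    exact (norm_exp_neg_I_mul_mul_le (f := fun x => dT u (x, s)) hk (le_of_lt hx)).trans
      (hM x s hx hs.1.le hs.2.le)
  · refine (ae_restrict_iff' measurableSet_Ioi).2 (Eventually.of_forall fun x hx s hs => ?_)
    exact (hasDerivAt_dT hu (le_of_lt hx) hs.1).const_mul _

end Quadrant

/-! ### The transformed system -/

/-- The half-line transforms of the solution satisfy a linear system of ordinary differential
equations, forced by the boundary values. -/
theorem IsSmoothSolution.exists_transformed_system {r₀ q₀ g₀ : ℝ → ℂ} {r q : ℝ → ℝ → ℂ}
    (hsol : IsSmoothSolution r₀ q₀ g₀ r q) (hr : DecaysAtInfinity r) (hq : DecaysAtInfinity q) :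
    ∃ g₁ h : ℝ → ℂ, ContinuousOn g₁ (Ici 0) ∧ ContinuousOn h (Ici 0) ∧
      (∀ t, 0 < t → HasDerivAt g₀ (g₁ t) t) ∧
      ∀ k : ℂ, k.im ≤ 0 → ∀ t, 0 < t →
        HasDerivAt (fun t => halfFourier (fun x => r x t) k)
          (g₀ t - I * k * halfFourier (fun x => q x t) k) t ∧
        ∃ Q' : ℂ, HasDerivAt (fun t => halfFourier (fun x => q x t) k) Q' t ∧
          (1 + k ^ 2) * Q' = h t - I * k * g₁ t - I * k * halfFourier (fun x => r x t) k := by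
  set u : ℝ × ℝ → ℂ := fun p => r p.1 p.2 with hu_def
  set v : ℝ × ℝ → ℂ := fun p => q p.1 p.2 with hv_def
  have hu : ContDiffOn ℝ ∞ u quadrant := hsol.smooth_r
  have hv : ContDiffOn ℝ ∞ v quadrant := hsol.smooth_q
  have hur : DecaysAtInfinity fun x t => u (x, t) := hr
  have hvq : DecaysAtInfinity fun x t => v (x, t) := hq
  have hp := contDiffOn_dT hv
  have hvx := contDiffOn_dX hv
  have hpx := contDiffOn_dT hvx
  have hE1 : ∀ x t : ℝ, 0 < x → 0 < t → dT u (x, t) = -dX v (x, t) := by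
    intro x t hx ht
    have h1 : partialDeriv 0 1 r x t = dT u (x, t) := partialDeriv_eq hu 0 1 hx ht
    have h2 : partialDeriv 1 0 q x t = dX v (x, t) := partialDeriv_eq hv 1 0 hx ht
    have h3 := hsol.eq_r x t hx ht
    rw [h1, h2] at h3
    exact eq_neg_of_add_eq_zero_left h3
  have hE2 : ∀ x t : ℝ, 0 < x → 0 < t →
      dT (dX (dX v)) (x, t) - dX u (x, t) = dT v (x, t) := by
    intro x t hx ht
    have h1 : partialDeriv 0 1 q x t = dT v (x, t) := partialDeriv_eq hv 0 1 hx ht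
    have h2 : partialDeriv 1 0 r x t = dX u (x, t) := partialDeriv_eq hu 1 0 hx ht
    have h3 : partialDeriv 2 1 q x t = dT (dX (dX v)) (x, t) := partialDeriv_eq hv 2 1 hx ht
    have h4 := hsol.eq_q x t hx ht
    rw [h1, h2, h3] at h4
    linear_combination -h4
  have h0 : (0 : ℝ) ∈ Ici (0 : ℝ) := mem_Ici.2 le_rfl
  have hg : ∀ t, 0 ≤ t → v (0, t) = g₀ t := fun t ht => hsol.bdry_q t ht
  -- The boundary values are `g₁ = q_t(0,t)` and the unprescribed combination `h = r(0,t) -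
  -- q_xt(0,t)`.
  refine ⟨fun t => dT v (0, t), fun t => u (0, t) - dT (dX v) (0, t),
    continuousOn_slice_snd hp.continuousOn le_rfl,
    (continuousOn_slice_snd hu.continuousOn le_rfl).sub
      (continuousOn_slice_snd hpx.continuousOn le_rfl), ?_, ?_⟩
  · intro t ht
    refine (hasDerivAt_dT hv le_rfl ht).congr_of_eventuallyEq ?_
    filter_upwards [Ioi_mem_nhds ht] with s hs using (hg s (le_of_lt hs)).symm
  intro k hk t ht
  have dec_u := hasQuadraticDecay_slice hu hur (a := 0) (b := 0) (by norm_num) (by norm_num) ht.le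
  have dec_v := hasQuadraticDecay_slice hv hvq (a := 0) (b := 0) (by norm_num) (by norm_num) ht.le
  have dec_vx := hasQuadraticDecay_slice hv hvq (a := 1) (b := 0) (by norm_num) (by norm_num) ht.le
  have dec_p := hasQuadraticDecay_slice hv hvq (a := 0) (b := 1) (by norm_num) (by norm_num) ht.le
  have dec_px := hasQuadraticDecay_slice hv hvq (a := 1) (b := 1) (by norm_num) (by norm_num) ht.le
  constructor
  · refine (hasDerivAt_halfFourier_slice hu hur hk ht).congr_deriv ?_
    have h1 : halfFourier (fun x => dT u (x, t)) k = -halfFourier (fun x => dX v (x, t)) k := by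
      unfold halfFourier
      rw [← integral_neg]
      refine setIntegral_congr_fun measurableSet_Ioi fun x hx => ?_
      simp only [hE1 x t hx ht, mul_neg]
    have h2 := halfFourier_deriv (f := fun x => v (x, t)) (f' := fun x => dX v (x, t)) dec_v dec_vx
      (continuousOn_slice_fst hv.continuousOn ht.le 0 h0) (fun x hx => hasDerivAt_dX hv hx ht.le) hk
    rw [h1, h2, hg t ht.le]
    simp only [hv_def]
    ring
  · refine ⟨_, hasDerivAt_halfFourier_slice hv hvq hk ht, ?_⟩
    have h1 := halfFourier_deriv (f := fun x => dT v (x, t)) (f' := fun x => dT (dX v) (x, t))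
      dec_p dec_px (continuousOn_slice_fst hp.continuousOn ht.le 0 h0) (fun x hx => by
        rw [← dX_dT_comm hv hx ht]
        exact hasDerivAt_dX hp hx ht.le) hk
    -- The second equation says `q_t = ∂ₓ(q_xt - r)`, so it is transformed as a derivative.
    have h2 := halfFourier_deriv (f := fun x => dT (dX v) (x, t) - u (x, t))
      (f' := fun x => dT v (x, t)) (dec_px.sub dec_u) dec_p
      ((continuousOn_slice_fst hpx.continuousOn ht.le 0 h0).sub
        (continuousOn_slice_fst hu.continuousOn ht.le 0 h0)) (fun x hx => by
        have := (hasDerivAt_dX hpx hx ht.le).sub (hasDerivAt_dX hu hx ht.le)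
        rw [dX_dT_comm hvx hx ht, hE2 x t hx ht] at this
        exact this) hk
    have h3 : halfFourier (fun x => dT (dX v) (x, t) - u (x, t)) k =
        halfFourier (fun x => dT (dX v) (x, t)) k - halfFourier (fun x => u (x, t)) k :=
      halfFourier_sub dec_px dec_u hk
    rw [h3, h1] at h2
    change (1 + k ^ 2) * halfFourier (fun x => dT v (x, t)) k =
      u (0, t) - dT (dX v) (0, t) - I * k * dT v (0, t) - I * k * halfFourier (fun x => u (x, t)) k
    linear_combination h2 + k ^ 2 * halfFourier (fun x => dT v (x, t)) k * I_sq

/-! ### The branch `μ` and even functions of it -/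

/-- Multiplication by `i` turns the direction `-i` into the positive real axis, so the angle is `arg
(iz)` modulo `2π`. -/
theorem norm_mul_exp_angleFromBelow (z : ℂ) : (‖z‖ : ℂ) * exp (I * angleFromBelow z) = I * z := by
  have h1 : exp (I * angleFromBelow z) = exp (arg (I * z) * I) := by
    rw [angleFromBelow, toIcoMod]
    rw [show I * ((arg (I * z) - toIcoDiv Real.two_pi_pos 0 (arg (I * z)) • (2 * Real.pi) : ℝ) : ℂ)
      = arg (I * z) * I - (toIcoDiv Real.two_pi_pos 0 (arg (I * z)) : ℤ) * (2 * Real.pi * I) by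
        push_cast
        simp only [zsmul_eq_mul]
        ring]
    exact exp_periodic.sub_int_mul_eq _
  rw [h1]
  have h2 := norm_mul_exp_arg_mul_I (I * z)
  rwa [norm_mul, norm_I, one_mul] at h2

/-- Each of the two angles contributes a factor `i`, and the shift by `-π` compensates `i² = -1`.
Nothing else about the branch is used later. -/
theorem mu_sq (k : ℂ) : mu k ^ 2 = 1 + k ^ 2 := by
  have h1 := norm_mul_exp_angleFromBelow (k + I)
  have h2 := norm_mul_exp_angleFromBelow (k - I)
  have hfac : 1 + k ^ 2 = (k + I) * (k - I) := by linear_combination I_sq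
  have hs : ((Real.sqrt ‖1 + k ^ 2‖ : ℝ) : ℂ) ^ 2 = (‖k + I‖ : ℂ) * ‖k - I‖ := by
    rw [← ofReal_pow, Real.sq_sqrt (norm_nonneg _), hfac, norm_mul, ofReal_mul]
  have hexp :
      exp (I * ((angleFromBelow (k + I) + angleFromBelow (k - I) - Real.pi : ℝ) : ℂ) / 2) ^ 2 =
      -(exp (I * angleFromBelow (k + I)) * exp (I * angleFromBelow (k - I))) := by
    rw [← exp_nat_mul, ← exp_add, show ((2 : ℕ) : ℂ) *
      (I * ((angleFromBelow (k + I) + angleFromBelow (k - I) - Real.pi : ℝ) : ℂ) / 2) =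
      I * angleFromBelow (k + I) + I * angleFromBelow (k - I) - Real.pi * I by push_cast; ring,
      exp_sub, exp_pi_mul_I]
    ring
  rw [mu, mul_pow, hs, hexp]
  calc (‖k + I‖ : ℂ) * ‖k - I‖ *
        -(exp (I * angleFromBelow (k + I)) * exp (I * angleFromBelow (k - I)))
      = -((‖k + I‖ : ℂ) * exp (I * angleFromBelow (k + I)) *
        ((‖k - I‖ : ℂ) * exp (I * angleFromBelow (k - I)))) := by ring
    _ = 1 + k ^ 2 := by
      rw [h1, h2]
      linear_combination (-k ^ 2 + I ^ 2 - 1) * I_sq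

theorem mu_ne_zero {k : ℂ} (hk : k ∈ ({I, -I} : Set ℂ)ᶜ) : mu k ≠ 0 := fun h => by
  have h1 := mu_sq k
  rw [h, zero_pow two_ne_zero] at h1
  exact one_add_sq_ne_zero hk h1.symm

theorem omega_mul_mu {k : ℂ} (hk : k ∈ ({I, -I} : Set ℂ)ᶜ) : omega k * mu k = k :=
  div_mul_cancel₀ k (mu_ne_zero hk)

theorem omega_sq {k : ℂ} (hk : k ∈ ({I, -I} : Set ℂ)ᶜ) : omega k ^ 2 = omegaSq k := by
  have h := one_add_sq_ne_zero hk
  rw [omega, div_pow, mu_sq, omegaSq]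
  field_simp
  ring

theorem omega_div_mu (k : ℂ) : omega k / mu k = k / (1 + k ^ 2) := by
  rw [omega, div_div, ← sq, mu_sq]

theorem expSum_eq (k : ℂ) (t : ℝ) : expSum k t = 2 * cos (omega k * t) := by
  rw [expSum, Complex.cos, show I * omega k * t = omega k * t * I by ring,
    show -I * omega k * t = -(omega k * t) * I by ring]
  ring

theorem expDiff_eq (k : ℂ) (t : ℝ) : expDiff k t = 2 * I * sin (omega k * t) := by
  rw [expDiff, Complex.sin, show I * omega k * t = omega k * t * I by ring,
    show -I * omega k * t = -(omega k * t) * I by ring]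
  linear_combination (exp (omega k * t * I) - exp (-(omega k * t) * I)) * I_sq

theorem differentiable_tsum_pow {c : ℕ → ℂ} (hc : ∀ n, ‖c n‖ ≤ 1 / (n.factorial : ℝ)) :
    Differentiable ℂ fun z : ℂ => ∑' n, c n * z ^ n := by
  intro z
  have hR := Real.summable_pow_div_factorial (‖z‖ + 1)
  have hd := differentiableOn_tsum_of_summable_norm (F := fun n (w : ℂ) => c n * w ^ n) hR
    (fun n => Differentiable.differentiableOn (by fun_prop))
    (Metric.isOpen_ball : IsOpen (Metric.ball (0 : ℂ) (‖z‖ + 1))) (fun n w hw => by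
      rw [norm_mul, norm_pow]
      rw [mem_ball_zero_iff] at hw
      calc ‖c n‖ * ‖w‖ ^ n ≤ 1 / (n.factorial : ℝ) * (‖z‖ + 1) ^ n := by
            gcongr
            exact hc n
        _ = (‖z‖ + 1) ^ n / (n.factorial : ℝ) := by ring)
  exact hd.differentiableAt (Metric.isOpen_ball.mem_nhds (by simp))

/-- The entire function with `cosSqrt (s ^ 2) = cos s`. -/
def cosSqrt (z : ℂ) : ℂ := ∑' n : ℕ, (-1) ^ n / ((2 * n).factorial : ℂ) * z ^ n

/-- The entire function with `s * sincSqrt (s ^ 2) = sin s`. -/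
def sincSqrt (z : ℂ) : ℂ := ∑' n : ℕ, (-1) ^ n / ((2 * n + 1).factorial : ℂ) * z ^ n

theorem differentiable_cosSqrt : Differentiable ℂ cosSqrt := by
  refine differentiable_tsum_pow fun n => ?_
  rw [norm_div, norm_pow, norm_neg, norm_one, one_pow, norm_natCast]
  have : n.factorial ≤ (2 * n).factorial := Nat.factorial_le (by omega)
  gcongr

theorem differentiable_sincSqrt : Differentiable ℂ sincSqrt := by
  refine differentiable_tsum_pow fun n => ?_
  rw [norm_div, norm_pow, norm_neg, norm_one, one_pow, norm_natCast]
  have : n.factorial ≤ (2 * n + 1).factorial := Nat.factorial_le (by omega)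
  gcongr

theorem cosSqrt_sq (s : ℂ) : cosSqrt (s ^ 2) = cos s := by
  rw [cosSqrt, ← (Complex.hasSum_cos s).tsum_eq]
  refine tsum_congr fun n => ?_
  rw [← pow_mul]
  ring

theorem mul_sincSqrt_sq (s : ℂ) : s * sincSqrt (s ^ 2) = sin s := by
  rw [sincSqrt, ← (Complex.hasSum_sin s).tsum_eq, ← tsum_mul_left]
  refine tsum_congr fun n => ?_
  rw [← pow_mul]
  ring

/-! ### Time convolutions -/

/-- `∫₀ᵗ cos(ω(t - τ)) φ(τ) dτ`. -/
def cosConv (φ : ℝ → ℂ) (w : ℂ) (t : ℝ) : ℂ :=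
  ∫ τ in (0 : ℝ)..t, cos (w * ((t : ℂ) - τ)) * φ τ

/-- `∫₀ᵗ sin(ω(t - τ)) φ(τ) dτ`. -/
def sinConv (φ : ℝ → ℂ) (w : ℂ) (t : ℝ) : ℂ :=
  ∫ τ in (0 : ℝ)..t, sin (w * ((t : ℂ) - τ)) * φ τ

/-- `∫₀ᵗ C(z (t - τ)²) φ(τ) dτ`. -/
def entireConv (C : ℂ → ℂ) (φ : ℝ → ℂ) (t : ℝ) (z : ℂ) : ℂ :=
  ∫ τ in (0 : ℝ)..t, C (z * ((t : ℂ) - τ) ^ 2) * φ τ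

theorem differentiable_entireConv {C : ℂ → ℂ} (hC : Differentiable ℂ C) {φ : ℝ → ℂ} {t : ℝ}
    (hφ : IntervalIntegrable φ volume 0 t) : Differentiable ℂ (entireConv C φ t) := by
  intro z
  have hcC : Continuous C := hC.continuous
  have hcC' : Continuous (deriv C) := (hC.contDiff (n := 1)).continuous_deriv le_rfl
  set K : ℂ → ℝ → ℂ := fun w τ => ((t : ℂ) - τ) ^ 2 * deriv C (w * ((t : ℂ) - τ) ^ 2) with hK
  have hKc : Continuous fun p : ℂ × ℝ => K p.1 p.2 := by fun_prop
  obtain ⟨M, hM⟩ := ((isCompact_closedBall z 1).prod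
    (isCompact_uIcc (a := (0 : ℝ)) (b := t))).exists_bound_of_continuousOn hKc.continuousOn
  refine (intervalIntegral.hasDerivAt_integral_of_dominated_loc_of_deriv_le
    (F := fun w τ => C (w * ((t : ℂ) - τ) ^ 2) * φ τ) (F' := fun w τ => K w τ * φ τ)
    (bound := fun τ => M * ‖φ τ‖) (Metric.ball_mem_nhds z one_pos) ?_ ?_ ?_ ?_
    (hφ.norm.const_mul M) ?_).2.differentiableAt
  · refine Eventually.of_forall fun w => ?_
    exact (Continuous.aestronglyMeasurable (by fun_prop)).mul
      (intervalIntegrable_iff.1 hφ).aestronglyMeasurable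
  · exact hφ.continuousOn_mul (Continuous.continuousOn (by fun_prop))
  · have : Continuous fun τ => K z τ := by fun_prop
    exact this.aestronglyMeasurable.mul (intervalIntegrable_iff.1 hφ).aestronglyMeasurable
  · refine Eventually.of_forall fun τ hτ w hw => ?_
    rw [norm_mul]
    exact mul_le_mul_of_nonneg_right
      (hM (w, τ) ⟨Metric.ball_subset_closedBall hw, uIoc_subset_uIcc hτ⟩) (norm_nonneg _)
  · refine Eventually.of_forall fun τ _ w _ => ?_
    have h1 : HasDerivAt (fun w : ℂ => w * ((t : ℂ) - τ) ^ 2) (((t : ℂ) - τ) ^ 2) w := by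
      simpa using (hasDerivAt_id w).mul_const (((t : ℂ) - τ) ^ 2)
    refine (((hC _).hasDerivAt.comp w h1).mul_const (φ τ)).congr_deriv ?_
    simp only [hK]
    ring

theorem cosConv_eq {φ : ℝ → ℂ} {w : ℂ} {t : ℝ} :
    cosConv φ w t = entireConv cosSqrt φ t (w ^ 2) := by
  unfold cosConv entireConv
  simp only [← mul_pow, cosSqrt_sq]

/-- The sine convolution is odd in `w`: one factor `w(t - τ)` comes out of the sine and the rest
depends on `w²` only. This parity removes the ambiguity of the sign of `μ`. -/
theorem sinConv_eq {φ : ℝ → ℂ} {w : ℂ} {t : ℝ} :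
    sinConv φ w t = w * entireConv sincSqrt (fun τ => ((t : ℂ) - τ) * φ τ) t (w ^ 2) := by
  unfold sinConv entireConv
  rw [← intervalIntegral.integral_const_mul]
  refine intervalIntegral.integral_congr fun τ _ => ?_
  simp only
  rw [← mul_sincSqrt_sq, mul_pow]
  ring

theorem intervalIntegrable_exp_mul {φ : ℝ → ℂ} {t : ℝ} (hφ : IntervalIntegrable φ volume 0 t)
    (w : ℂ) : IntervalIntegrable (fun τ : ℝ => exp (-I * w * τ) * φ τ) volume 0 t :=
  hφ.continuousOn_mul (Continuous.continuousOn (by fun_prop))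

theorem transSum_eq {φ : ℝ → ℂ} {t : ℝ} (hφ : IntervalIntegrable φ volume 0 t) (k : ℂ) :
    transSum φ k t = 2 * cosConv φ (omega k) t := by
  unfold transSum timeTransform cosConv
  rw [← intervalIntegral.integral_const_mul, ← intervalIntegral.integral_const_mul,
    ← intervalIntegral.integral_const_mul, ← intervalIntegral.integral_add
      ((intervalIntegrable_exp_mul hφ _).const_mul _)
      ((intervalIntegrable_exp_mul hφ _).const_mul _)]
  refine intervalIntegral.integral_congr fun τ _ => ?_
  rw [← mul_assoc, ← mul_assoc, ← exp_add, ← exp_add, Complex.cos,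
    show I * omega k * t + -I * omega k * τ = omega k * ((t : ℂ) - τ) * I by ring,
    show -I * omega k * t + -I * -omega k * τ = -(omega k * ((t : ℂ) - τ)) * I by ring]
  ring

theorem transDiff_eq {φ : ℝ → ℂ} {t : ℝ} (hφ : IntervalIntegrable φ volume 0 t) (k : ℂ) :
    transDiff φ k t = 2 * I * sinConv φ (omega k) t := by
  unfold transDiff timeTransform sinConv
  rw [← intervalIntegral.integral_const_mul, ← intervalIntegral.integral_const_mul,
    ← intervalIntegral.integral_const_mul, ← intervalIntegral.integral_sub
      ((intervalIntegrable_exp_mul hφ _).const_mul _)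
      ((intervalIntegrable_exp_mul hφ _).const_mul _)]
  refine intervalIntegral.integral_congr fun τ _ => ?_
  rw [← mul_assoc, ← mul_assoc, ← exp_add, ← exp_add, Complex.sin,
    show I * omega k * t + -I * omega k * τ = omega k * ((t : ℂ) - τ) * I by ring,
    show -I * omega k * t + -I * -omega k * τ = -(omega k * ((t : ℂ) - τ)) * I by ring]
  linear_combination (φ τ * (exp (omega k * ((t : ℂ) - τ) * I) -
    exp (-(omega k * ((t : ℂ) - τ)) * I))) * I_sq

/-- Needed because the two-sided `deriv g₀` at 0 depends on values of `g₀` at negative times, about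
which nothing is known. -/
theorem timeTransform_congr {φ ψ : ℝ → ℂ} {t : ℝ} (ht : 0 ≤ t) (h : ∀ τ, 0 < τ → φ τ = ψ τ)
    (w : ℂ) : timeTransform φ w t = timeTransform ψ w t := by
  refine intervalIntegral.integral_congr_ae (Eventually.of_forall fun τ hτ => ?_)
  rw [uIoc_of_le ht] at hτ
  simp only [h τ hτ.1]

/-- Variation of constants for the transformed system. -/
theorem duhamel {R Q R' Q' g g₁ h : ℝ → ℂ} {k μ w : ℂ} {t : ℝ} (ht : 0 ≤ t)
    (hμ : μ ^ 2 = 1 + k ^ 2) (hμ0 : μ ≠ 0) (hw : w * μ = k)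
    (hR : ContinuousOn R (Icc 0 t)) (hQ : ContinuousOn Q (Icc 0 t))
    (hg : ContinuousOn g (Icc 0 t)) (hg₁ : ContinuousOn g₁ (Icc 0 t))
    (hh : ContinuousOn h (Icc 0 t))
    (hR' : ∀ τ, 0 < τ → HasDerivAt R (R' τ) τ) (hQ' : ∀ τ, 0 < τ → HasDerivAt Q (Q' τ) τ)
    (eR : ∀ τ, 0 < τ → R' τ = g τ - I * k * Q τ)
    (eQ : ∀ τ, 0 < τ → (1 + k ^ 2) * Q' τ = h τ - I * k * g₁ τ - I * k * R τ) :
    R t = cos (w * t) * R 0 - I * μ * sin (w * t) * Q 0 +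
        (cosConv g w t - I / μ * (sinConv h w t - I * k * sinConv g₁ w t)) ∧
    Q t = cos (w * t) * Q 0 - I / μ * sin (w * t) * R 0 +
        ((cosConv h w t - I * k * cosConv g₁ w t) / μ ^ 2 - I / μ * sinConv g w t) := by
  have hcosd : ∀ τ : ℝ, HasDerivAt (fun τ : ℝ => cos (w * ((t : ℂ) - τ)))
      (w * sin (w * ((t : ℂ) - τ))) τ := by
    intro τ
    have h1 : HasDerivAt (fun τ : ℝ => w * ((t : ℂ) - τ)) (-w) τ := by
      simpa using ((Complex.ofRealCLM.hasDerivAt (x := τ)).const_sub (t : ℂ)).const_mul w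
    exact ((hasDerivAt_cos _).comp τ h1).congr_deriv (by ring)
  have hsind : ∀ τ : ℝ, HasDerivAt (fun τ : ℝ => sin (w * ((t : ℂ) - τ)))
      (-w * cos (w * ((t : ℂ) - τ))) τ := by
    intro τ
    have h1 : HasDerivAt (fun τ : ℝ => w * ((t : ℂ) - τ)) (-w) τ := by
      simpa using ((Complex.ofRealCLM.hasDerivAt (x := τ)).const_sub (t : ℂ)).const_mul w
    exact ((hasDerivAt_sin _).comp τ h1).congr_deriv (by ring)
  have ii : ∀ {φ : ℝ → ℂ}, ContinuousOn φ (Icc 0 t) → IntervalIntegrable φ volume 0 t :=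
    fun hφ => ContinuousOn.intervalIntegrable (by rwa [uIcc_of_le ht])
  have ic : ∀ {φ : ℝ → ℂ}, ContinuousOn φ (Icc 0 t) →
      IntervalIntegrable (fun τ : ℝ => cos (w * ((t : ℂ) - τ)) * φ τ) volume 0 t :=
    fun hφ => (ii hφ).continuousOn_mul (Continuous.continuousOn (by fun_prop))
  have is : ∀ {φ : ℝ → ℂ}, ContinuousOn φ (Icc 0 t) →
      IntervalIntegrable (fun τ : ℝ => sin (w * ((t : ℂ) - τ)) * φ τ) volume 0 t :=
    fun hφ => (ii hφ).continuousOn_mul (Continuous.continuousOn (by fun_prop))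
  have eQ' : ∀ τ, 0 < τ → Q' τ = (h τ - I * k * g₁ τ - I * k * R τ) / μ ^ 2 := by
    intro τ hτ
    rw [eq_div_iff (pow_ne_zero 2 hμ0), hμ, mul_comm, eQ τ hτ]
  have hwk : k = w * μ := hw.symm
  constructor
  -- This combination is constant in `τ` along the unforced flow and equals `R t` at `τ = t`, so its
  -- derivative contains the forcing only. The second component is treated in the same way.
  · have key := integral_eq_of_hasDerivAt_off_countable_of_le
      (fun τ : ℝ => cos (w * ((t : ℂ) - τ)) * R τ - I * μ * sin (w * ((t : ℂ) - τ)) * Q τ)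
      (fun τ : ℝ => cos (w * ((t : ℂ) - τ)) * g τ - I / μ * (sin (w * ((t : ℂ) - τ)) * h τ -
        I * k * (sin (w * ((t : ℂ) - τ)) * g₁ τ))) ht countable_empty
      ((ContinuousOn.mul (by fun_prop) hR).sub (ContinuousOn.mul (by fun_prop) hQ))
      (fun τ hτ => by
        have hτ0 : 0 < τ := hτ.1.1
        refine (((hcosd τ).mul (hR' τ hτ0)).sub
          (((hsind τ).const_mul (I * μ)).mul (hQ' τ hτ0))).congr_deriv ?_
        rw [eR τ hτ0, eQ' τ hτ0, hwk]
        field_simp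
        linear_combination (μ * w * sin (w * ((t : ℂ) - τ)) * R τ) * I_sq)
      ((ic hg).sub (((is hh).sub ((is hg₁).const_mul (I * k))).const_mul (I / μ)))
    rw [intervalIntegral.integral_sub (ic hg)
      (((is hh).sub ((is hg₁).const_mul (I * k))).const_mul (I / μ)),
      intervalIntegral.integral_const_mul, intervalIntegral.integral_sub (is hh)
      ((is hg₁).const_mul (I * k)), intervalIntegral.integral_const_mul] at key
    simp only [sub_self, mul_zero, Complex.cos_zero, Complex.sin_zero, one_mul, zero_mul, sub_zero,
      ofReal_zero] at key
    unfold cosConv sinConv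
    linear_combination -key
  · have key := integral_eq_of_hasDerivAt_off_countable_of_le
      (fun τ : ℝ => cos (w * ((t : ℂ) - τ)) * Q τ - I / μ * sin (w * ((t : ℂ) - τ)) * R τ)
      (fun τ : ℝ => 1 / μ ^ 2 * (cos (w * ((t : ℂ) - τ)) * h τ -
        I * k * (cos (w * ((t : ℂ) - τ)) * g₁ τ)) - I / μ * (sin (w * ((t : ℂ) - τ)) * g τ))
      ht countable_empty
      ((ContinuousOn.mul (by fun_prop) hQ).sub (ContinuousOn.mul (by fun_prop) hR))
      (fun τ hτ => by
        have hτ0 : 0 < τ := hτ.1.1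
        refine (((hcosd τ).mul (hQ' τ hτ0)).sub
          (((hsind τ).const_mul (I / μ)).mul (hR' τ hτ0))).congr_deriv ?_
        rw [eR τ hτ0, eQ' τ hτ0, hwk]
        field_simp
        linear_combination (w * sin (w * ((t : ℂ) - τ)) * Q τ * μ ^ 2) * I_sq)
      ((((ic hh).sub ((ic hg₁).const_mul (I * k))).const_mul (1 / μ ^ 2)).sub
        ((is hg).const_mul (I / μ)))
    rw [intervalIntegral.integral_sub (((ic hh).sub ((ic hg₁).const_mul (I * k))).const_mul _)
      ((is hg).const_mul (I / μ)),
      intervalIntegral.integral_const_mul, intervalIntegral.integral_sub (ic hh)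
      ((ic hg₁).const_mul (I * k)), intervalIntegral.integral_const_mul,
      intervalIntegral.integral_const_mul] at key
    simp only [sub_self, mul_zero, Complex.cos_zero, Complex.sin_zero, one_mul, zero_mul, sub_zero,
      ofReal_zero] at key
    unfold cosConv sinConv
    linear_combination -key

/-! ### The representation of the solution -/

theorem halfFourier_congr {f g : ℝ → ℂ} (h : ∀ x, 0 ≤ x → f x = g x) :
    halfFourier f = halfFourier g := by
  funext k
  refine setIntegral_congr_fun measurableSet_Ioi fun x hx => ?_
  simp only [h x (le_of_lt hx)]

theorem IsSmoothSolution.continuousOn_boundary {r₀ q₀ g₀ : ℝ → ℂ} {r q : ℝ → ℝ → ℂ}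
    (hsol : IsSmoothSolution r₀ q₀ g₀ r q) : ContinuousOn g₀ (Ici 0) :=
  (continuousOn_slice_snd (u := fun p => q p.1 p.2) hsol.smooth_q.continuousOn le_rfl).congr
    fun t ht => (hsol.bdry_q t ht).symm

/-- The transforms of the solution in terms of the data and the boundary values. -/
theorem IsSmoothSolution.exists_transform_eq {r₀ q₀ g₀ : ℝ → ℂ} {r q : ℝ → ℝ → ℂ}
    (hsol : IsSmoothSolution r₀ q₀ g₀ r q) (hr : DecaysAtInfinity r) (hq : DecaysAtInfinity q) :
    ∃ g₁ h : ℝ → ℂ, ContinuousOn g₁ (Ici 0) ∧ ContinuousOn h (Ici 0) ∧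
      (∀ t, 0 < t → HasDerivAt g₀ (g₁ t) t) ∧
      ∀ k μ w : ℂ, k.im ≤ 0 → μ ^ 2 = 1 + k ^ 2 → μ ≠ 0 → w * μ = k → ∀ t : ℝ, 0 ≤ t →
        halfFourier (fun x => r x t) k =
          cos (w * t) * halfFourier r₀ k - I * μ * sin (w * t) * halfFourier q₀ k +
          (cosConv g₀ w t - I / μ * (sinConv h w t - I * k * sinConv g₁ w t)) ∧
        halfFourier (fun x => q x t) k =
          cos (w * t) * halfFourier q₀ k - I / μ * sin (w * t) * halfFourier r₀ k +
          ((cosConv h w t - I * k * cosConv g₁ w t) / μ ^ 2 - I / μ * sinConv g₀ w t) := by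
  obtain ⟨g₁, h, hg₁, hh, hder, hsys⟩ := hsol.exists_transformed_system hr hq
  refine ⟨g₁, h, hg₁, hh, hder, fun k μ w hk hμ hμ0 hw t ht => ?_⟩
  -- The implication allows a dummy value for `τ ≤ 0`, so that `choose` yields a function on all of
  -- `ℝ`.
  have hQ : ∀ τ, ∃ Q' : ℂ, 0 < τ → HasDerivAt (fun t => halfFourier (fun x => q x t) k) Q' τ ∧
      (1 + k ^ 2) * Q' = h τ - I * k * g₁ τ - I * k * halfFourier (fun x => r x τ) k := by
    intro τ
    by_cases hτ : 0 < τ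
    · obtain ⟨Q', h1⟩ := (hsys k hk τ hτ).2
      exact ⟨Q', fun _ => h1⟩
    · exact ⟨0, fun h1 => absurd h1 hτ⟩
  choose Q' hQ' using hQ
  have key := duhamel (R := fun t => halfFourier (fun x => r x t) k)
    (Q := fun t => halfFourier (fun x => q x t) k) (Q' := Q') (g := g₀) (g₁ := g₁) (h := h)
    ht hμ hμ0 hw
    (continuousOn_halfFourier_slice (u := fun p => r p.1 p.2) hsol.smooth_r hr hk t)
    (continuousOn_halfFourier_slice (u := fun p => q p.1 p.2) hsol.smooth_q hq hk t)
    (hsol.continuousOn_boundary.mono Icc_subset_Ici_self) (hg₁.mono Icc_subset_Ici_self)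
    (hh.mono Icc_subset_Ici_self)
    (fun τ hτ => (hsys k hk τ hτ).1) (fun τ hτ => (hQ' τ hτ).1) (fun τ _ => rfl)
    (fun τ hτ => (hQ' τ hτ).2)
  rwa [halfFourier_congr hsol.init_r, halfFourier_congr hsol.init_q] at key

/-- By parity `μ` enters only through `ω/μ = k/(1 + k²)` and `kω/μ = ω²`, which are single-valued
off `±i`. -/
theorem boundaryTerm_r_eq {g g₁ h : ℝ → ℂ} {t : ℝ} {k : ℂ} (hk : k ∈ ({I, -I} : Set ℂ)ᶜ) :
    cosConv g (omega k) t - I / mu k * (sinConv h (omega k) t - I * k * sinConv g₁ (omega k) t) =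
      boundaryForm (fun z => entireConv cosSqrt g t z -
          z * entireConv sincSqrt (fun τ => ((t : ℂ) - τ) * g₁ τ) t z)
        (entireConv sincSqrt (fun τ => ((t : ℂ) - τ) * h τ) t) (fun _ => 0) k := by
  have h1 := omega_div_mu k
  have h2 := omega_sq hk
  have h3 := omega_mul_mu hk
  have h4 := mu_ne_zero hk
  have h5 : k * (omega k / mu k) = omegaSq k := by
    rw [← h2]
    nth_rewrite 1 [← h3]
    field_simp
  rw [cosConv_eq, sinConv_eq, sinConv_eq, h2]
  simp only [boundaryForm, zero_div, add_zero]
  rw [mul_div_assoc I k, ← h1, ← h5]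
  linear_combination (k * (omega k / mu k) *
    entireConv sincSqrt (fun τ => ((t : ℂ) - τ) * g₁ τ) t (k * (omega k / mu k))) * I_sq

theorem boundaryTerm_q_eq {g g₁ h : ℝ → ℂ} {t : ℝ} {k : ℂ} (hk : k ∈ ({I, -I} : Set ℂ)ᶜ) :
    (cosConv h (omega k) t - I * k * cosConv g₁ (omega k) t) / mu k ^ 2 -
        I / mu k * sinConv g (omega k) t =
      boundaryForm (fun _ => 0) (fun z => entireConv cosSqrt g₁ t z +
          entireConv sincSqrt (fun τ => ((t : ℂ) - τ) * g τ) t z)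
        (entireConv cosSqrt h t) k := by
  have h1 := omega_div_mu k
  rw [cosConv_eq, cosConv_eq, sinConv_eq, omega_sq hk, mu_sq]
  simp only [boundaryForm]
  linear_combination (-I * entireConv sincSqrt (fun τ => ((t : ℂ) - τ) * g τ) t (omegaSq k)) * h1

/-- Evaluates the limit `A 1` of the boundary term at `k = ∞`, where `ω² = 1`. The integrand is the
exact derivative of `-sin(t - τ) g(τ)`; hence the condition `q₀(0) sin t = 0`. -/
theorem cosConv_one_sub_sinConv_one {g g₁ : ℝ → ℂ} {t : ℝ} (ht : 0 ≤ t)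
    (hg : ContinuousOn g (Icc 0 t)) (hg₁ : ContinuousOn g₁ (Icc 0 t))
    (hd : ∀ τ, 0 < τ → HasDerivAt g (g₁ τ) τ) :
    cosConv g 1 t - sinConv g₁ 1 t = sin t * g 0 := by
  have ii : ∀ {φ : ℝ → ℂ}, ContinuousOn φ (Icc 0 t) → IntervalIntegrable φ volume 0 t :=
    fun hφ => ContinuousOn.intervalIntegrable (by rwa [uIcc_of_le ht])
  have ic : IntervalIntegrable (fun τ : ℝ => cos (1 * ((t : ℂ) - τ)) * g τ) volume 0 t :=
    (ii hg).continuousOn_mul (Continuous.continuousOn (by fun_prop))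
  have is : IntervalIntegrable (fun τ : ℝ => sin (1 * ((t : ℂ) - τ)) * g₁ τ) volume 0 t :=
    (ii hg₁).continuousOn_mul (Continuous.continuousOn (by fun_prop))
  have key := integral_eq_of_hasDerivAt_off_countable_of_le
    (fun τ : ℝ => -(sin (1 * ((t : ℂ) - τ)) * g τ))
    (fun τ : ℝ => cos (1 * ((t : ℂ) - τ)) * g τ - sin (1 * ((t : ℂ) - τ)) * g₁ τ) ht
    countable_empty (ContinuousOn.neg (ContinuousOn.mul (by fun_prop) hg))
    (fun τ hτ => by
      have h1 : HasDerivAt (fun τ : ℝ => 1 * ((t : ℂ) - τ)) (-1) τ := by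
        simpa using (Complex.ofRealCLM.hasDerivAt (x := τ)).const_sub (t : ℂ)
      refine (((hasDerivAt_sin _).comp τ h1).mul (hd τ hτ.1.1)).neg.congr_deriv ?_
      simp only [Function.comp_apply]
      ring) (ic.sub is)
  rw [intervalIntegral.integral_sub ic is] at key
  unfold cosConv sinConv
  rw [key]
  simp

/-- `N` stands for `e^{ikx}` times the transform of the solution at `-k`; being analytic also at
`i`, it drops out by Cauchy's theorem. Continuity of `f₂` follows from the identity. -/
theorem IsContourAroundI.contourIntegral_add_eq {γ : ℝ → ℂ} (hγ : IsContourAroundI γ)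
    {F N f₁ f₂ : ℂ → ℂ} {c : ℂ} (hF : ContinuousOn F ({k | 0 < k.im} \ {I}))
    (hN : DifferentiableOn ℂ N {k | 0 < k.im}) (hf₁ : ContinuousOn f₁ ({k | 0 < k.im} \ {I}))
    (h : ∀ k ∈ {k : ℂ | 0 < k.im} \ {I}, f₁ k + f₂ k = c * F k + N k) :
    contourIntegral γ f₁ + contourIntegral γ f₂ = c * contourIntegral γ F := by
  have hN' : ContinuousOn N ({k | 0 < k.im} \ {I}) := hN.continuousOn.mono sdiff_subset
  have hcF : ContinuousOn (fun k => c * F k) ({k | 0 < k.im} \ {I}) := continuousOn_const.mul hF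
  have hf₂ : ContinuousOn f₂ ({k | 0 < k.im} \ {I}) :=
    ((hcF.add hN').sub hf₁).congr fun k hk => by
      simp only [Pi.add_apply, Pi.sub_apply]
      linear_combination h k hk
  have hz := hγ.contourIntegral_eq_zero_of_differentiableOn hN
  rw [← add_zero (c * contourIntegral γ F), ← hz]
  unfold contourIntegral
  rw [← intervalIntegral.integral_const_mul,
    ← intervalIntegral.integral_add (hγ.intervalIntegrable_comp hf₁)
      (hγ.intervalIntegrable_comp hf₂),
    ← intervalIntegral.integral_add ((hγ.intervalIntegrable_comp hF).const_mul c)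
      (hγ.intervalIntegrable_comp hN')]
  refine intervalIntegral.integral_congr fun s hs => ?_
  rw [uIcc_of_le zero_le_one] at hs
  have := h (γ s) ⟨hγ.upper s hs, hγ.avoids s hs⟩
  linear_combination (deriv γ s) * this

theorem differentiableOn_exp_mul_halfFourier_neg {f : ℝ → ℂ} (hf : HasQuadraticDecay f) (x : ℝ) :
    DifferentiableOn ℂ (fun k => exp (I * k * x) * halfFourier f (-k)) {k | 0 < k.im} := by
  intro k hk
  have hk' : (-k).im < 0 := by simpa using hk
  have h1 : DifferentiableAt ℂ (fun k => halfFourier f (-k)) k :=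
    (hf.differentiableAt_halfFourier hk').comp k differentiableAt_id.neg
  exact (DifferentiableAt.mul (by fun_prop) h1).differentiableWithinAt

theorem continuousOn_halfFourier_neg {f : ℝ → ℂ} (hf : HasQuadraticDecay f) :
    ContinuousOn (fun k => halfFourier f (-k)) ({k | 0 < k.im} \ {I}) := by
  intro k hk
  have hk' : (-k).im < 0 := by simpa using hk.1
  exact (ContinuousAt.comp (f := fun k : ℂ => -k)
    (hf.differentiableAt_halfFourier hk').continuousAt (by fun_prop)).continuousWithinAt

theorem continuousOn_omegaSq : ContinuousOn omegaSq ({k | 0 < k.im} \ {I}) := fun _ hk =>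
  (differentiableAt_omegaSq (upper_sdiff_subset_compl hk)).continuousAt.continuousWithinAt

/-- The branch `μ` jumps across its cut, so continuity comes from the expression through `ω²`. -/
theorem continuousOn_cos_omega (t : ℝ) :
    ContinuousOn (fun k => cos (omega k * t)) ({k | 0 < k.im} \ {I}) := by
  have h1 : ContinuousOn (fun k => cosSqrt (omegaSq k * (t : ℂ) ^ 2)) ({k | 0 < k.im} \ {I}) :=
    differentiable_cosSqrt.continuous.comp_continuousOn
      (continuousOn_omegaSq.mul continuousOn_const)
  refine h1.congr fun k hk => ?_
  simp only
  rw [← omega_sq (upper_sdiff_subset_compl hk), ← mul_pow, cosSqrt_sq]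

theorem continuousOn_sin_omega_div_mu (t : ℝ) :
    ContinuousOn (fun k => 1 / mu k * sin (omega k * t)) ({k | 0 < k.im} \ {I}) := by
  have h1 : ContinuousOn (fun k : ℂ => k / (1 + k ^ 2) * t * sincSqrt (omegaSq k * (t : ℂ) ^ 2))
      ({k | 0 < k.im} \ {I}) :=
    ((continuousOn_id.div (by fun_prop) fun k hk =>
      one_add_sq_ne_zero (upper_sdiff_subset_compl hk)).mul continuousOn_const).mul
      (differentiable_sincSqrt.continuous.comp_continuousOn
        (continuousOn_omegaSq.mul continuousOn_const))
  refine h1.congr fun k hk => ?_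
  simp only
  rw [← omega_sq (upper_sdiff_subset_compl hk), ← mul_pow, ← mul_sincSqrt_sq, ← omega_div_mu]
  ring

theorem continuousOn_mu_mul_sin_omega (t : ℝ) :
    ContinuousOn (fun k => mu k * sin (omega k * t)) ({k | 0 < k.im} \ {I}) := by
  have h1 : ContinuousOn (fun k : ℂ => (1 + k ^ 2) * (1 / mu k * sin (omega k * t)))
      ({k | 0 < k.im} \ {I}) :=
    ContinuousOn.mul (by fun_prop) (continuousOn_sin_omega_div_mu t)
  refine h1.congr fun k hk => ?_
  have := mu_ne_zero (upper_sdiff_subset_compl hk)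
  simp only
  rw [← mu_sq]
  field_simp

theorem continuousOn_exp_mul_boundaryForm {A B E : ℂ → ℂ} (hA : Differentiable ℂ A)
    (hB : Differentiable ℂ B) (hE : Differentiable ℂ E) (x : ℝ) :
    ContinuousOn (fun k => exp (I * k * x) * boundaryForm A B E k) ({k | 0 < k.im} \ {I}) := by
  intro k hk
  exact (ContinuousAt.mul (by fun_prop) (differentiableAt_boundaryForm hA hB hE
    (upper_sdiff_subset_compl hk)).continuousAt).continuousWithinAt

theorem HasQuadraticDecay.bounded_exp_mul_halfFourier {f : ℝ → ℂ} (hf : HasQuadraticDecay f)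
    (x : ℝ) : (Continuous fun k : ℝ => exp (I * k * x) * halfFourier f k) ∧
      ∀ k : ℝ, ‖exp (I * k * x) * halfFourier f k‖ ≤ ∫ y in Ioi (0 : ℝ), ‖f y‖ := by
  refine ⟨Continuous.mul (by fun_prop) hf.continuous_halfFourier, fun k => ?_⟩
  rw [norm_mul, norm_exp_I_mul_ofReal_mul, one_mul]
  exact hf.norm_halfFourier_le (by simp)

end LinearBoussinesq

end

/-! ### The representation formulas for `r` and `q` -/

open LinearBoussinesq in
theorem mainTheorem2 (r₀ q₀ g₀ : ℝ → ℂ) (r q : ℝ → ℝ → ℂ)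
    (hsol : LinearBoussinesq.IsSmoothSolution r₀ q₀ g₀ r q)
    (hr : LinearBoussinesq.DecaysAtInfinity r) (hq : LinearBoussinesq.DecaysAtInfinity q)
    (γ : ℝ → ℂ) (hγ : LinearBoussinesq.IsContourAroundI γ)
    (x t : ℝ) (hx : 0 < x) (ht : 0 ≤ t) :
    (∃ J : ℂ,
      LinearBoussinesq.HasAbelIntegral (fun k : ℝ => Complex.exp (Complex.I * k * x) * (1 / 2) *
        (LinearBoussinesq.expSum k t * LinearBoussinesq.halfFourier r₀ k -
          LinearBoussinesq.mu k * LinearBoussinesq.expDiff k t *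
            LinearBoussinesq.halfFourier q₀ k)) J ∧
      (q₀ 0 * Real.sin t = 0 →
        LinearBoussinesq.HasImproperIntegral
          (fun k : ℝ => Complex.exp (Complex.I * k * x) * (1 / 2) *
            (LinearBoussinesq.expSum k t * LinearBoussinesq.halfFourier r₀ k -
              LinearBoussinesq.mu k * LinearBoussinesq.expDiff k t *
                LinearBoussinesq.halfFourier q₀ k)) J) ∧
      r x t = 1 / (2 * Real.pi) * J
        + 1 / (2 * Real.pi) * LinearBoussinesq.contourIntegral γ (fun k =>
            Complex.exp (Complex.I * k * x) * (1 / 2) *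
              (LinearBoussinesq.expSum k t * LinearBoussinesq.halfFourier r₀ (-k) +
                LinearBoussinesq.mu k * LinearBoussinesq.expDiff k t *
                  LinearBoussinesq.halfFourier q₀ (-k)))
        + 1 / (2 * Real.pi) * LinearBoussinesq.contourIntegral γ (fun k =>
            Complex.exp (Complex.I * k * x) *
              (LinearBoussinesq.transSum g₀ k t +
                Complex.I * LinearBoussinesq.omega k *
                  LinearBoussinesq.transDiff (deriv g₀) k t))) ∧
    (∃ J : ℂ,
      LinearBoussinesq.HasImproperIntegral
        (fun k : ℝ => Complex.exp (Complex.I * k * x) * (1 / 2) *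
          (LinearBoussinesq.expSum k t * LinearBoussinesq.halfFourier q₀ k -
            1 / LinearBoussinesq.mu k * LinearBoussinesq.expDiff k t *
              LinearBoussinesq.halfFourier r₀ k)) J ∧
      q x t = 1 / (2 * Real.pi) * J
        - 1 / (2 * Real.pi) * LinearBoussinesq.contourIntegral γ (fun k =>
            Complex.exp (Complex.I * k * x) * (1 / 2) *
              (LinearBoussinesq.expSum k t * LinearBoussinesq.halfFourier q₀ (-k) +
                1 / LinearBoussinesq.mu k * LinearBoussinesq.expDiff k t *
                  LinearBoussinesq.halfFourier r₀ (-k)))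
        - 1 / (2 * Real.pi) * LinearBoussinesq.contourIntegral γ (fun k =>
            Complex.exp (Complex.I * k * x) *
              (1 / LinearBoussinesq.mu k * LinearBoussinesq.transDiff g₀ k t +
                Complex.I * k / (1 + k ^ 2) *
                  LinearBoussinesq.transSum (deriv g₀) k t))) := by
  obtain ⟨g₁, h, hg₁, hh, hder, hrep⟩ := hsol.exists_transform_eq hr hq
  have hg₀ := hsol.continuousOn_boundary
  have ii : ∀ {φ : ℝ → ℂ}, ContinuousOn φ (Ici 0) → IntervalIntegrable φ volume 0 t :=
    fun hφ => ContinuousOn.intervalIntegrable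
      (by rw [uIcc_of_le ht]; exact hφ.mono Icc_subset_Ici_self)
  have ii' : ∀ {φ : ℝ → ℂ}, ContinuousOn φ (Ici 0) →
      IntervalIntegrable (fun τ : ℝ => ((t : ℂ) - τ) * φ τ) volume 0 t :=
    fun hφ => (ii hφ).continuousOn_mul (Continuous.continuousOn (by fun_prop))
  have h2pi : 1 / (2 * Real.pi : ℂ) * (2 * Real.pi) = 1 :=
    one_div_mul_cancel (mul_ne_zero two_ne_zero (by exact_mod_cast Real.pi_ne_zero))
  have hcompl : ∀ k ∈ {k : ℂ | 0 < k.im} \ {I}, k ∈ ({I, -I} : Set ℂ)ᶜ :=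
    fun k hk => upper_sdiff_subset_compl hk
  have hrt : HasQuadraticDecay fun y => r y t :=
    hasQuadraticDecay_slice (u := fun p => r p.1 p.2) hsol.smooth_r hr (a := 0) (b := 0)
      (by norm_num) (by norm_num) ht
  have hqt : HasQuadraticDecay fun y => q y t :=
    hasQuadraticDecay_slice (u := fun p => q p.1 p.2) hsol.smooth_q hq (a := 0) (b := 0)
      (by norm_num) (by norm_num) ht
  have hr0 : ContinuousOn (fun k => halfFourier r₀ (-k)) ({k | 0 < k.im} \ {I}) := by
    rw [← halfFourier_congr hsol.init_r]
    exact continuousOn_halfFourier_neg (hasQuadraticDecay_slice (u := fun p => r p.1 p.2)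
      hsol.smooth_r hr (a := 0) (b := 0) (by norm_num) (by norm_num) le_rfl)
  have hq0 : ContinuousOn (fun k => halfFourier q₀ (-k)) ({k | 0 < k.im} \ {I}) := by
    rw [← halfFourier_congr hsol.init_q]
    exact continuousOn_halfFourier_neg (hasQuadraticDecay_slice (u := fun p => q p.1 p.2)
      hsol.smooth_q hq (a := 0) (b := 0) (by norm_num) (by norm_num) le_rfl)
  have hinvr := hasImproperIntegral_slice (u := fun p => r p.1 p.2) hsol.smooth_r hr hx ht
  have hinvq := hasImproperIntegral_slice (u := fun p => q p.1 p.2) hsol.smooth_q hq hx ht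
  have hdS : ∀ k, transSum (deriv g₀) k t = 2 * cosConv g₁ (omega k) t := by
    intro k
    rw [← transSum_eq (ii hg₁)]
    unfold transSum
    simp only [timeTransform_congr ht fun τ hτ => (hder τ hτ).deriv]
  have hdD : ∀ k, transDiff (deriv g₀) k t = 2 * I * sinConv g₁ (omega k) t := by
    intro k
    rw [← transDiff_eq (ii hg₁)]
    unfold transDiff
    simp only [timeTransform_congr ht fun τ hτ => (hder τ hτ).deriv]
  have hreal : ∀ k : ℝ, _ := fun k : ℝ => hrep k (mu k) (omega k) (by simp) (mu_sq k)
    (mu_ne_zero (ofReal_mem_compl k)) (omega_mul_mu (ofReal_mem_compl k)) t ht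
  -- The relation at `-k` is taken with the root `-μ(k)`, so that `ω` is unchanged and no knowledge
  -- of `mu (-k)` is needed.
  have hneg : ∀ k ∈ {k : ℂ | 0 < k.im} \ {I}, _ := fun k hk =>
    hrep (-k) (-mu k) (omega k) (by
        have : 0 < k.im := hk.1
        rw [neg_im]
        linarith) (by rw [neg_sq, neg_sq, mu_sq])
      (neg_ne_zero.2 (mu_ne_zero (hcompl k hk)))
      (by rw [mul_neg, omega_mul_mu (hcompl k hk)]) t ht
  constructor
  · set A : ℂ → ℂ := fun z => entireConv cosSqrt g₀ t z -
      z * entireConv sincSqrt (fun τ => ((t : ℂ) - τ) * g₁ τ) t z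
    set B : ℂ → ℂ := entireConv sincSqrt (fun τ => ((t : ℂ) - τ) * h τ) t
    have hA : Differentiable ℂ A :=
      (differentiable_entireConv differentiable_cosSqrt (ii hg₀)).sub
        (differentiable_id.mul (differentiable_entireConv differentiable_sincSqrt (ii' hg₁)))
    have hB : Differentiable ℂ B := differentiable_entireConv differentiable_sincSqrt (ii' hh)
    have hE : Differentiable ℂ fun _ : ℂ => (0 : ℂ) := differentiable_const _
    have hA1 : A 1 = sin t * q₀ 0 := by
      have h1 := cosConv_one_sub_sinConv_one ht (hg₀.mono Icc_subset_Ici_self)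
        (hg₁.mono Icc_subset_Ici_self) hder
      rw [cosConv_eq, sinConv_eq, one_pow] at h1
      rw [← hsol.init_q 0 le_rfl, hsol.bdry_q 0 le_rfl, ← h1]
    obtain ⟨hb1, hb2, M, hb3⟩ := hγ.hasImproperIntegral_boundaryForm hA hB hE hx
    obtain ⟨hc1, hc2⟩ := hrt.bounded_exp_mul_halfFourier x
    -- The data term is the transform of the solution minus the boundary term; the constant `A 1` is
    -- split off because only its Abel integral exists.
    have hint : (fun k : ℝ => exp (I * k * x) * (1 / 2) * (expSum k t * halfFourier r₀ k -
        mu k * expDiff k t * halfFourier q₀ k)) = fun k : ℝ =>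
        (exp (I * k * x) * halfFourier (fun y => r y t) k -
          exp (I * k * x) * (boundaryForm A B (fun _ => 0) k - A 1)) - A 1 * exp (I * k * x) := by
      funext k
      rw [(hreal k).1, ← boundaryTerm_r_eq (ofReal_mem_compl k), expSum_eq, expDiff_eq]
      ring
    refine ⟨2 * Real.pi * r x t -
      contourIntegral γ (fun k => exp (I * k * x) * boundaryForm A B (fun _ => 0) k), ?_, ?_, ?_⟩
    · rw [hint]
      have := ((hinvr.hasAbelIntegral hc1 hc2).sub (hb1.hasAbelIntegral hb2 hb3)).sub
        ((hasAbelIntegral_exp hx.ne').const_mul (A 1))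
      rwa [mul_zero, sub_zero] at this
    · intro h0
      have hA0 : A 1 = 0 := by
        rw [hA1, mul_comm, ← ofReal_sin]
        exact h0
      rw [hint]
      simp only [hA0, zero_mul, sub_zero] at hb1 ⊢
      exact hinvr.sub hb1
    -- In `R` the unknown `h` has the factor `1/μ`, which changes sign at `-k`; the sum therefore
    -- eliminates it.
    · have hcont := hγ.contourIntegral_add_eq (c := 1)
        (F := fun k => exp (I * k * x) * boundaryForm A B (fun _ => 0) k)
        (N := fun k => exp (I * k * x) * halfFourier (fun y => r y t) (-k))
        (f₁ := fun k => exp (I * k * x) * (1 / 2) *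
          (expSum k t * halfFourier r₀ (-k) + mu k * expDiff k t * halfFourier q₀ (-k)))
        (f₂ := fun k => exp (I * k * x) *
          (transSum g₀ k t + I * omega k * transDiff (deriv g₀) k t))
        (continuousOn_exp_mul_boundaryForm hA hB hE x)
        (differentiableOn_exp_mul_halfFourier_neg hrt x) ?_ ?_
      · rw [one_mul] at hcont
        linear_combination (-(r x t)) * h2pi - 1 / (2 * Real.pi : ℂ) * hcont
      · have h1 : ContinuousOn (fun k => exp (I * k * x) *
            (cos (omega k * t) * halfFourier r₀ (-k) +
              I * (mu k * sin (omega k * t)) * halfFourier q₀ (-k))) ({k | 0 < k.im} \ {I}) :=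
          ContinuousOn.mul (by fun_prop) (((continuousOn_cos_omega t).mul hr0).add
            ((continuousOn_const.mul (continuousOn_mu_mul_sin_omega t)).mul hq0))
        refine h1.congr fun k hk => ?_
        simp only
        rw [expSum_eq, expDiff_eq]
        ring
      · intro k hk
        have h5 : omega k = k / mu k := rfl
        rw [(hneg k hk).1, ← boundaryTerm_r_eq (hcompl k hk), expSum_eq, expDiff_eq,
          transSum_eq (ii hg₀), hdD, div_neg]
        linear_combination (exp (I * k * x) * 2 * sinConv g₁ (omega k) t * I ^ 2) * h5
  · set B : ℂ → ℂ := fun z => entireConv cosSqrt g₁ t z +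
      entireConv sincSqrt (fun τ => ((t : ℂ) - τ) * g₀ τ) t z
    set E : ℂ → ℂ := entireConv cosSqrt h t
    have hA : Differentiable ℂ fun _ : ℂ => (0 : ℂ) := differentiable_const _
    have hB : Differentiable ℂ B :=
      (differentiable_entireConv differentiable_cosSqrt (ii hg₁)).add
        (differentiable_entireConv differentiable_sincSqrt (ii' hg₀))
    have hE : Differentiable ℂ E := differentiable_entireConv differentiable_cosSqrt (ii hh)
    have hb1 := (hγ.hasImproperIntegral_boundaryForm hA hB hE hx).1
    have hint : (fun k : ℝ => exp (I * k * x) * (1 / 2) * (expSum k t * halfFourier q₀ k -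
        1 / mu k * expDiff k t * halfFourier r₀ k)) = fun k : ℝ =>
        exp (I * k * x) * halfFourier (fun y => q y t) k -
          exp (I * k * x) * (boundaryForm (fun _ => 0) B E k - 0) := by
      funext k
      rw [(hreal k).2, ← boundaryTerm_q_eq (ofReal_mem_compl k), expSum_eq, expDiff_eq]
      ring
    refine ⟨2 * Real.pi * q x t -
      contourIntegral γ (fun k => exp (I * k * x) * boundaryForm (fun _ => 0) B E k), ?_, ?_⟩
    · rw [hint]
      exact hinvq.sub hb1
    -- In `Q` the unknown `h` has the even factor `1/μ²`, so here the difference eliminates it.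
    · have hcont := hγ.contourIntegral_add_eq (c := -1)
        (F := fun k => exp (I * k * x) * boundaryForm (fun _ => 0) B E k)
        (N := fun k => exp (I * k * x) * halfFourier (fun y => q y t) (-k))
        (f₁ := fun k => exp (I * k * x) * (1 / 2) *
          (expSum k t * halfFourier q₀ (-k) + 1 / mu k * expDiff k t * halfFourier r₀ (-k)))
        (f₂ := fun k => exp (I * k * x) *
          (1 / mu k * transDiff g₀ k t + I * k / (1 + k ^ 2) * transSum (deriv g₀) k t))
        (continuousOn_exp_mul_boundaryForm hA hB hE x)
        (differentiableOn_exp_mul_halfFourier_neg hqt x) ?_ ?_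
      · linear_combination (-(q x t)) * h2pi + 1 / (2 * Real.pi : ℂ) * hcont
      · have h1 : ContinuousOn (fun k => exp (I * k * x) *
            (cos (omega k * t) * halfFourier q₀ (-k) +
              I * (1 / mu k * sin (omega k * t)) * halfFourier r₀ (-k))) ({k | 0 < k.im} \ {I}) :=
          ContinuousOn.mul (by fun_prop) (((continuousOn_cos_omega t).mul hq0).add
            ((continuousOn_const.mul (continuousOn_sin_omega_div_mu t)).mul hr0))
        refine h1.congr fun k hk => ?_
        simp only
        rw [expSum_eq, expDiff_eq]
        ring
      · intro k hk
        rw [(hneg k hk).2, ← boundaryTerm_q_eq (hcompl k hk), expSum_eq, expDiff_eq,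
          transDiff_eq (ii hg₀), hdS, div_neg, neg_sq, mu_sq]
        ring
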